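/- Let $T\in(0,\infty)$, let $(\Omega,\mathcal F,\mathbb P)$ be a probability space with a filtration $(\mathcal F_t)_{t\in[0,T]}$ that is right-continuous and such that $\mathcal F_0$ contains all $\mathbb P$-null sets of $\mathcal F$, and let $W$ be a standard one-dimensional $(\mathcal F_t)$-Brownian motion on $[0,T]$. Let $0<\tau_1<\tau_2<T$ and let $f,g,h\in C^\infty(\mathbb R)$ be bounded with $\{f\ne0\}\subseteq(-\infty,\tau_1]$, $\inf_{t\in[0,\tau_1/2]}|f'(t)|>0$, $\{g\neq 0\}\subseteq[\tau_1,\tau_2]$, $g\ne0$, $\{h\neq 0\}\subseteq[\tau_2,\infty)$ and $\int_{\tau_2}^T h(t)\,dt\ne0$. For $\psi\in C^\infty(\mathbb R)$ consider the four-dimensional SDE with initial value $X^\psi(0)=0$, $$dX^\psi(t)=\mu^\psi(X^\psi(t))\,dt+\sigma(X^\psi(t))\,dW(t),\quad t\in[0,T],$$ $$\mu^\psi(x)=\bigl(1,0,0,h(x_1)\cos(x_2\psi(x_3))\bigr),\quad \sigma(x)=\bigl(0,f(x_1),g(x_1),0\bigr).$$ For $\delta\in(0,T]$ let $\mathcal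 X^\delta$ be the class of approximations $\widehat X$ given by measurable maps $\varphi_n:\mathbb R^{n-1}\times\mathbb R^{[\delta,T]}\to(0,\delta)$, $\chi_n:\mathbb R^n\times\mathbb R^{[\delta,T]}\to\{0,1\}$, $\phi_n:\mathbb R^n\times\mathbb R^{[\delta,T]}\to\mathbb R^4$, $n\in\mathbb N=\{1,2,\dots\}$, as follows. With $v=(W(t))_{t\in[\delta,T]}$ one observes successively $y_n=W(\varphi_n(y_1,\dots,y_{n-1},v))$, stops after $\nu=\min\{n\in\mathbb N:\chi_n(y_1,\dots,y_n,v)=1\}$ observations, and returns $\widehat X=\phi_\nu(y_1,\dots,y_\nu,v)$. It is required that $\nu<\infty$ almost surely and that $\varphi_k(y_1,\dots,y_{k-1},v)\ne\varphi_l(y_1,\dots,y_{l-1},v)$ for all $k\ne l$, all real sequences $y$ and all continuous $v$. For $N\in\mathbb N$ let $\mathcal X^\delta_N$ be the set of those $\widehat X\in\mathcal X^\delta$ with $\mathbb E\,\nu\le N$. Let $(a_N)_{N\in\mathbb N}\subset(0,\infty)$ and $(\delta_N)_{N\in\mathbb N}\subset(0,T]$ satisfy $\lim_{N\to\infty}a_N=0$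 and $\lim_{N\to\infty}\delta_N=0$. Then there exist $\kappa>0$ and $\psi\in C^\infty(\mathbb R)$ such that the SDE above has a strong solution and, for every strong solution $X^\psi$ and all $N\in\mathbb N$, $$\inf_{\widehat X\in\mathcal X^{\delta_N}_N}\mathbb E\bigl\|X^\psi(T)-\widehat X\bigr\|\ \ge\ \kappa\cdot a_N,$$ where $\|\cdot\|$ is the Euclidean norm and an expectation may be $+\infty$. -/

import Mathlib

open MeasureTheory ProbabilityTheory Filter Topology Set
open scoped ENNReal NNReal

/-! Processes on `[0, T]` are represented by families indexed by `ℝ`; only the times in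
`[0, T]` matter. -/

section StochasticBasis

variable {Ω : Type*} {mΩ : MeasurableSpace Ω}

/-- A normal filtration on `[0, T]`: it is right-continuous and `𝓕 0` contains all null sets. -/
structure IsNormalFiltration (P : Measure Ω) (T : ℝ) (𝓕 : Filtration ℝ mΩ) : Prop where
  null_sets : ∀ A : Set Ω, MeasurableSet[mΩ] A → P A = 0 → MeasurableSet[𝓕 0] A
  right_continuous : ∀ t ∈ Ico 0 T, (⨅ s ∈ Ioc t T, 𝓕 s) = 𝓕 t

/-- `W` is a standard one-dimensional `𝓕`-Brownian motion on `[0, T]`. -/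
structure IsStandardBrownianMotion (P : Measure Ω) (T : ℝ) (𝓕 : Filtration ℝ mΩ)
    (W : ℝ → Ω → ℝ) : Prop where
  adapted : ∀ t ∈ Icc 0 T, Measurable[𝓕 t] (W t)
  start : ∀ᵐ ω ∂P, W 0 ω = 0
  continuous_paths : ∀ᵐ ω ∂P, ContinuousOn (fun t => W t ω) (Icc 0 T)
  law_increment : ∀ s t : ℝ, 0 ≤ s → s ≤ t → t ≤ T →
    P.map (fun ω => W t ω - W s ω) = gaussianReal 0 (t - s).toNNReal
  indep_increment : ∀ s t : ℝ, 0 ≤ s → s ≤ t → t ≤ T →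
    Indep (MeasurableSpace.comap (fun ω => W t ω - W s ω) inferInstance) (𝓕 s) P

/-- A simple predictable process `∑_{i < n} ξ i · 1_{(grid i, grid (i+1)]}` on `[0, T]`, with
bounded coefficients `ξ i` that are `𝓕 (grid i)`-measurable. -/
structure SimpleProcess (T : ℝ) (𝓕 : Filtration ℝ mΩ) where
  n : ℕ
  grid : ℕ → ℝ
  grid_mono : Monotone grid
  grid_mem : ∀ i, grid i ∈ Icc 0 T
  ξ : ℕ → Ω → ℝ
  ξ_measurable : ∀ i, Measurable[𝓕 (grid i)] (ξ i)
  ξ_bounded : ∃ C : ℝ, ∀ i ω, |ξ i ω| ≤ C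

namespace SimpleProcess

variable {T : ℝ} {𝓕 : Filtration ℝ mΩ}

/-- The value of the simple process at time `s`. -/
noncomputable def value (H : SimpleProcess T 𝓕) (s : ℝ) (ω : Ω) : ℝ :=
  ∑ i ∈ Finset.range H.n, (Ioc (H.grid i) (H.grid (i + 1))).indicator (fun _ => H.ξ i ω) s

/-- The elementary stochastic integral `∫₀ᵗ H dW`. -/
noncomputable def integral (H : SimpleProcess T 𝓕) (W : ℝ → Ω → ℝ) (t : ℝ) (ω : Ω) : ℝ :=
  ∑ i ∈ Finset.range H.n,
    H.ξ i ω * (W (min (H.grid (i + 1)) t) ω - W (min (H.grid i) t) ω)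

end SimpleProcess

/-- `I t = ∫₀ᵗ H s dW s` almost surely for every `t ∈ [0, T]`, in the sense of Itô: for some
sequence of simple processes converging to `H` in `L²(Ω × [0, T])`, the elementary integrals
up to time `t` converge to `I t` in `L²(Ω)`, for every `t ∈ [0, T]`. This is the Itô integral
of square-integrable (in particular of bounded) integrands. -/
def IsItoIntegral (P : Measure Ω) (T : ℝ) (𝓕 : Filtration ℝ mΩ) (W H I : ℝ → Ω → ℝ) : Prop :=
  ∃ S : ℕ → SimpleProcess T 𝓕,
    Tendsto (fun k => ∫⁻ ω, (∫⁻ s in Icc 0 T, ‖(S k).value s ω - H s ω‖ₑ ^ 2) ∂P) atTop (𝓝 0) ∧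
    ∀ t ∈ Icc 0 T,
      Tendsto (fun k => ∫⁻ ω, ‖(S k).integral W t ω - I t ω‖ₑ ^ 2 ∂P) atTop (𝓝 0)

/-- `X` is a strong solution on `[0, T]` of `dX = μ(X) dt + σ(X) dW`, `X 0 = x₀`, for a bounded
diffusion coefficient `σ` and a one-dimensional `𝓕`-Brownian motion `W`: an adapted process with
almost surely continuous paths which satisfies the integral equation coordinatewise. -/
structure IsStrongSolution (P : Measure Ω) (T : ℝ) (𝓕 : Filtration ℝ mΩ) (W : ℝ → Ω → ℝ)
    {d : ℕ} (μ σ : EuclideanSpace ℝ (Fin d) → EuclideanSpace ℝ (Fin d))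
    (x₀ : EuclideanSpace ℝ (Fin d)) (X : ℝ → Ω → EuclideanSpace ℝ (Fin d)) : Prop where
  adapted : ∀ t ∈ Icc 0 T, Measurable[𝓕 t] (X t)
  continuous_paths : ∀ᵐ ω ∂P, ContinuousOn (fun t => X t ω) (Icc 0 T)
  start : ∀ᵐ ω ∂P, X 0 ω = x₀
  drift_integrable : ∀ᵐ ω ∂P, ∀ i, IntervalIntegrable (fun s => μ (X s ω) i) volume 0 T
  equation : ∀ i, IsItoIntegral P T 𝓕 W (fun s ω => σ (X s ω) i)
    (fun t ω => X t ω i - x₀ i - ∫ s in (0 : ℝ)..t, μ (X s ω) i)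

end StochasticBasis

/-- The drift coefficient `x ↦ (1, 0, 0, h(x₁) cos(x₂ ψ(x₃)))`. -/
noncomputable def driftCoeff (h ψ : ℝ → ℝ) (x : EuclideanSpace ℝ (Fin 4)) :
    EuclideanSpace ℝ (Fin 4) :=
  !₂[1, 0, 0, h (x 0) * Real.cos (x 1 * ψ (x 2))]

/-- The diffusion coefficient `x ↦ (0, f(x₁), g(x₁), 0)`. -/
noncomputable def diffusionCoeff (f g : ℝ → ℝ) (x : EuclideanSpace ℝ (Fin 4)) :
    EuclideanSpace ℝ (Fin 4) :=
  !₂[0, f (x 0), g (x 0), 0]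

/-- An adaptive method observing a path on `[δ, T]` and sequentially at points of `(0, δ)`.
`site n` selects the evaluation site number `n + 1` from the first `n` observed values and the
path on `[δ, T]`; after `n + 1` evaluations, `halt n` decides whether to halt (`true`), in which
case `output n` is the approximation. The space `ℝ^{[δ, T]}` carries the product σ-algebra.
No site is used twice, whatever the observed values and the continuous path on `[δ, T]` are. -/
structure AdaptiveMethod (δ T : ℝ) where
  site : (n : ℕ) → (Fin n → ℝ) × (Icc δ T → ℝ) → ℝ
  site_measurable : ∀ n, Measurable (site n)
  site_mem : ∀ n D, site n D ∈ Ioo 0 δ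
  halt : (n : ℕ) → (Fin (n + 1) → ℝ) × (Icc δ T → ℝ) → Bool
  halt_measurable : ∀ n, Measurable (halt n)
  output : (n : ℕ) → (Fin (n + 1) → ℝ) × (Icc δ T → ℝ) → EuclideanSpace ℝ (Fin 4)
  output_measurable : ∀ n, Measurable (output n)
  site_ne : ∀ (y : ℕ → ℝ) (v : Icc δ T → ℝ), Continuous v → ∀ k l : ℕ, k ≠ l →
    site k (fun i => y i, v) ≠ site l (fun i => y i, v)

namespace AdaptiveMethod

variable {δ T : ℝ} (M : AdaptiveMethod δ T)

/-- The first `n` values observed along the path `w`. -/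
def observed (w : ℝ → ℝ) : (n : ℕ) → Fin n → ℝ
  | 0 => Fin.elim0
  | n + 1 => Fin.snoc (α := fun _ => ℝ) (observed w n)
      (w (M.site n (observed w n, fun t => w t)))

/-- The information available after `n` evaluations along the path `w`. -/
def data (w : ℝ → ℝ) (n : ℕ) : (Fin n → ℝ) × (Icc δ T → ℝ) :=
  (M.observed w n, fun t => w t)

/-- The method halts along the path `w` after finitely many evaluations. -/
def Terminates (w : ℝ → ℝ) : Prop := ∃ n, M.halt n (M.data w (n + 1)) = true

/-- The least `n` such that the method halts after `n + 1` evaluations (if there is one). -/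
noncomputable def haltIndex (w : ℝ → ℝ) : ℕ := sInf {n | M.halt n (M.data w (n + 1)) = true}

open Classical in
/-- The number of evaluations of the path `w` in `(0, δ)`. -/
noncomputable def numEval (w : ℝ → ℝ) : ℝ≥0∞ :=
  if M.Terminates w then (M.haltIndex w : ℝ≥0∞) + 1 else ⊤

/-- The approximation computed along the path `w` (irrelevant if the method does not halt). -/
noncomputable def result (w : ℝ → ℝ) : EuclideanSpace ℝ (Fin 4) :=
  M.output (M.haltIndex w) (M.data w (M.haltIndex w + 1))

end AdaptiveMethod

/-- The adaptive methods which halt almost surely and use on average at most `N` evaluations of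
`W` in `(0, δ)`. -/
def adaptiveMethods {Ω : Type*} {mΩ : MeasurableSpace Ω} (P : Measure Ω) (W : ℝ → Ω → ℝ)
    (δ T : ℝ) (N : ℕ) : Set (AdaptiveMethod δ T) :=
  {M | (∀ᵐ ω ∂P, M.Terminates fun t => W t ω) ∧
    (∫⁻ ω, M.numEval (fun t => W t ω) ∂P) ≤ N}

/-! ### Continuous version of the Brownian motion, its increments and covariance. -/

section BrownianMotion

variable {Ω : Type*} {mΩ : MeasurableSpace Ω} {P : Measure Ω} {T : ℝ} {𝓕 : Filtration ℝ mΩ}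
  {W B : ℝ → Ω → ℝ}

/-! The first component of a solution is time itself, so the second and third components are Itô
integrals of the deterministic functions f and g. Integration by parts turns them into path
integrals, which from time τ₂ on are frozen at Y = -∫₀^τ₁ f' W and Z = -∫₀^τ₂ g' W. Since h lives
after τ₂, the last component at time T is C cos(Y ψ(Z)) with C = ∫ h over [τ₂, T]. Itô's isometry
makes this hold for every strong solution (`IsStrongSolution.ae_eq_terminal`), and the pathwise
formula itself is a solution (`isStrongSolution_pathwiseSolution`).

A method that does not evaluate W in an interval (s, t) inside (0, min δ (τ₁/2)) learns nothing
about the height ξ of the Brownian bridge at the midpoint: W is a flattened path plus ξ times a tent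
function, and the flattened path is independent of ξ (`indepFun_flattened_bridgeHeight`). The
variable Z does not involve ξ, because g' vanishes before τ₁, whereas Y = Y' + q ξ with q ≠ 0,
because f' does not vanish on (s, t). Given the flattened path, the cosine thus has a Gaussian
argument with variance (q ψ(Z))² (t - s)/4. If this is at least 4, every guess has mean error at
least 1/32 (`le_integral_abs_cos_sub`).

Among 2n disjoint intervals, n evaluations leave at least n untouched, however adaptively they are
placed. With n chosen by Markov's inequality, a method of mean cost N has error at least |C| P(Z >
k) / 128 as soon as ψ ≥ K on (k, ∞), where K depends on N, δ and k but not on the method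
(`exists_frequency_bound`).

One ψ must serve all N. Since P(Z > j) > 0 for every j and a tends to 0, levels k_N can grow to
infinity so slowly that P(Z > k_N) ≥ κ a_N (`exists_tendsto_atTop_forall_le`). Because k_N tends to
infinity, the constraints ψ ≥ K_N on (k_N, ∞) are locally finite, and a smooth ψ satisfies all of
them (`exists_contDiff_forall_le`). -/

/-- A Brownian motion on `[0, T]` all of whose paths are continuous, start at `0`, and are
extended to `ℝ` by constants. -/
structure IsContinuousBrownianMotion (P : Measure Ω) (T : ℝ) (𝓕 : Filtration ℝ mΩ)
    (B : ℝ → Ω → ℝ) : Prop extends IsStandardBrownianMotion P T 𝓕 B where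
  continuous : ∀ ω, Continuous (fun t => B t ω)
  zero : ∀ ω, B 0 ω = 0
  measurable : ∀ t, Measurable (B t)

namespace IsStandardBrownianMotion

lemma measurable_of_mem (hW : IsStandardBrownianMotion P T 𝓕 W) {t : ℝ} (ht : t ∈ Icc 0 T) :
    Measurable (W t) := (hW.adapted t ht).mono (𝓕.le t) le_rfl

lemma congr (hW : IsStandardBrownianMotion P T 𝓕 W)
    (hB : ∀ t ∈ Icc 0 T, Measurable[𝓕 t] (B t))
    (h : ∀ᵐ ω ∂P, ∀ t ∈ Icc 0 T, B t ω = W t ω) (hT : 0 ≤ T) :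
    IsStandardBrownianMotion P T 𝓕 B where
  adapted := hB
  start := by
    filter_upwards [h, hW.start] with ω h1 h2
    rw [h1 0 ⟨le_rfl, hT⟩, h2]
  continuous_paths := by
    filter_upwards [h, hW.continuous_paths] with ω h1 h2
    exact h2.congr fun t ht => h1 t ht
  law_increment s t hs hst ht := by
    rw [← hW.law_increment s t hs hst ht]
    refine Measure.map_congr ?_
    filter_upwards [h] with ω h1
    rw [h1 t ⟨hs.trans hst, ht⟩, h1 s ⟨hs, hst.trans ht⟩]
  indep_increment s t hs hst ht := by
    have key := hW.indep_increment s t hs hst ht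
    rw [Indep_iff] at key ⊢
    rintro _ A ⟨U, hU, rfl⟩ hA
    have e : (fun ω => B t ω - B s ω) ⁻¹' U =ᵐ[P] (fun ω => W t ω - W s ω) ⁻¹' U := by
      filter_upwards [h] with ω h1
      change (B t ω - B s ω ∈ U) = (W t ω - W s ω ∈ U)
      rw [h1 t ⟨hs.trans hst, ht⟩, h1 s ⟨hs, hst.trans ht⟩]
    rw [measure_congr e, measure_congr (e.inter (ae_eq_refl A))]
    exact key _ _ ⟨U, hU, rfl⟩ hA

/-- A Brownian motion has a version with continuous paths. -/
lemma exists_continuous_version (h𝓕 : IsNormalFiltration P T 𝓕)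
    (hW : IsStandardBrownianMotion P T 𝓕 W) (hT : 0 ≤ T) :
    ∃ B : ℝ → Ω → ℝ, IsContinuousBrownianMotion P T 𝓕 B ∧
      ∀ᵐ ω ∂P, ∀ t ∈ Icc 0 T, B t ω = W t ω := by
  have hgood : ∀ᵐ ω ∂P, W 0 ω = 0 ∧ ContinuousOn (fun t => W t ω) (Icc 0 T) :=
    hW.start.and hW.continuous_paths
  -- The bad paths lie in a measurable null set, which belongs to 𝓕 0 as the filtration is normal;
  -- redefining the process to be 0 there keeps it adapted.
  set N := toMeasurable P {ω | ¬ (W 0 ω = 0 ∧ ContinuousOn (fun t => W t ω) (Icc 0 T))} with hN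
  have hNmeas : MeasurableSet N := measurableSet_toMeasurable _ _
  have hN0 : P N = 0 := by rw [hN, measure_toMeasurable]; exact hgood
  have hNF : ∀ t, 0 ≤ t → MeasurableSet[𝓕 t] N := fun t ht =>
    𝓕.mono ht _ (h𝓕.null_sets N hNmeas hN0)
  have hgoodN : ∀ ω ∉ N, W 0 ω = 0 ∧ ContinuousOn (fun t => W t ω) (Icc 0 T) := by
    intro ω hω
    by_contra hc
    exact hω (subset_toMeasurable _ _ hc)
  let B : ℝ → Ω → ℝ := fun t => (Nᶜ).indicator (W (projIcc 0 T hT t))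
  have hBad : ∀ t ∈ Icc 0 T, Measurable[𝓕 t] (B t) := by
    intro t ht
    have : (projIcc 0 T hT t : ℝ) = t := by rw [projIcc_of_mem hT ht]
    change Measurable[𝓕 t] ((Nᶜ).indicator (W (projIcc 0 T hT t)))
    rw [this]
    exact Measurable.indicator (hW.adapted t ht) (hNF t ht.1).compl
  have hBW : ∀ᵐ ω ∂P, ∀ t ∈ Icc 0 T, B t ω = W t ω := by
    have : ∀ᵐ ω ∂P, ω ∉ N := measure_eq_zero_iff_ae_notMem.1 hN0
    filter_upwards [this] with ω hω t ht
    change (Nᶜ).indicator (W (projIcc 0 T hT t)) ω = _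
    rw [indicator_of_mem (show ω ∈ Nᶜ from hω), projIcc_of_mem hT ht]
  refine ⟨B, { hW.congr hBad hBW hT with
    continuous := fun ω => ?_, zero := fun ω => ?_, measurable := fun t => ?_ }, hBW⟩
  · by_cases hω : ω ∈ N
    · have : (fun t => B t ω) = fun _ => 0 := by
        ext t
        exact indicator_of_notMem (by simpa using hω) _
      rw [this]; exact continuous_const
    · have : (fun t => B t ω) = (fun t => W t ω) ∘ (fun t => (projIcc 0 T hT t : ℝ)) := by
        ext t
        exact indicator_of_mem (show ω ∈ Nᶜ from hω) _
      rw [this]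
      exact (hgoodN ω hω).2.comp_continuous (by fun_prop) fun t => (projIcc 0 T hT t).2
  · by_cases hω : ω ∈ N
    · exact indicator_of_notMem (by simpa using hω) _
    · have : B 0 ω = W (projIcc 0 T hT 0) ω := indicator_of_mem (show ω ∈ Nᶜ from hω) _
      rw [this, projIcc_of_mem hT ⟨le_rfl, hT⟩]
      exact (hgoodN ω hω).1
  · exact (hW.measurable_of_mem (projIcc 0 T hT t).2).indicator hNmeas.compl

lemma hasLaw_increment (hW : IsStandardBrownianMotion P T 𝓕 W) {s t : ℝ} (hs : 0 ≤ s)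
    (hst : s ≤ t) (ht : t ≤ T) :
    HasLaw (fun ω => W t ω - W s ω) (gaussianReal 0 (t - s).toNNReal) P where
  aemeasurable := ((hW.measurable_of_mem ⟨hs.trans hst, ht⟩).sub
    (hW.measurable_of_mem ⟨hs, hst.trans ht⟩)).aemeasurable
  map_eq := hW.law_increment s t hs hst ht

lemma memLp_increment (hW : IsStandardBrownianMotion P T 𝓕 W) {s t : ℝ} (hs : 0 ≤ s)
    (hst : s ≤ t) (ht : t ≤ T) : MemLp (fun ω => W t ω - W s ω) 2 P :=
  (hW.hasLaw_increment hs hst ht).hasGaussianLaw.memLp_two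

lemma integral_increment (hW : IsStandardBrownianMotion P T 𝓕 W) {s t : ℝ} (hs : 0 ≤ s)
    (hst : s ≤ t) (ht : t ≤ T) : ∫ ω, W t ω - W s ω ∂P = 0 := by
  rw [(hW.hasLaw_increment hs hst ht).integral_eq, integral_id_gaussianReal]

lemma variance_increment (hW : IsStandardBrownianMotion P T 𝓕 W) {s t : ℝ} (hs : 0 ≤ s)
    (hst : s ≤ t) (ht : t ≤ T) : Var[fun ω => W t ω - W s ω; P] = t - s := by
  rw [(hW.hasLaw_increment hs hst ht).variance_eq, variance_id_gaussianReal,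
    Real.coe_toNNReal _ (by linarith)]

lemma integral_increment_sq (hW : IsStandardBrownianMotion P T 𝓕 W) {s t : ℝ} (hs : 0 ≤ s)
    (hst : s ≤ t) (ht : t ≤ T) : ∫ ω, (W t ω - W s ω) ^ 2 ∂P = t - s := by
  rw [← hW.variance_increment hs hst ht, variance_of_integral_eq_zero
    (hW.hasLaw_increment hs hst ht).aemeasurable (hW.integral_increment hs hst ht)]

/-- The increment with the largest index is independent of the past σ-algebra, with respect to which
all other increments are measurable; peeling it off gives an induction. -/
lemma hasIndepIncrements [IsProbabilityMeasure P] (hW : IsStandardBrownianMotion P T 𝓕 W) :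
    HasIndepIncrements (fun (t : Icc 0 T) ω => W t ω) P := by
  refine HasIndepIncrements.of_nat fun t ht _ => ?_
  rw [iIndepFun_iff]
  intro S A hA
  induction S using Finset.induction_on_max with
  | empty => simp
  | insert a S hmax ih =>
    have hnot : a ∉ S := fun h => (hmax a h).false
    rw [Finset.set_biInter_insert, Finset.prod_insert hnot,
      ← ih fun i hi => hA i (Finset.mem_insert_of_mem hi)]
    refine (Indep_iff _ _ _).1 (hW.indep_increment (t a) (t (a + 1)) (t a).2.1 (ht a.le_succ)
      (t (a + 1)).2.2) _ _ (hA a (Finset.mem_insert_self _ _)) ?_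
    refine Finset.measurableSet_biInter _ fun i hi => ?_
    obtain ⟨U, hU, h⟩ := hA i (Finset.mem_insert_of_mem hi)
    rw [← h]
    have h1 : (t (i + 1) : ℝ) ≤ t a := ht (hmax i hi)
    have h2 : (t i : ℝ) ≤ t a := ht (hmax i hi).le
    exact (((hW.adapted _ (t (i + 1)).2).mono (𝓕.mono h1) le_rfl).sub
      ((hW.adapted _ (t i).2).mono (𝓕.mono h2) le_rfl)) hU

end IsStandardBrownianMotion

namespace IsContinuousBrownianMotion

lemma hasLaw (hB : IsContinuousBrownianMotion P T 𝓕 B) {t : ℝ} (ht : t ∈ Icc 0 T) :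
    HasLaw (B t) (gaussianReal 0 t.toNNReal) P := by
  simpa [hB.zero] using hB.hasLaw_increment le_rfl ht.1 ht.2

lemma isGaussianProcess [IsProbabilityMeasure P] (hB : IsContinuousBrownianMotion P T 𝓕 B) [Fact (0 ≤ T)] :
    IsGaussianProcess (fun (t : Icc 0 T) ω => B t ω) P :=
  hB.hasIndepIncrements.isGaussianProcess (fun t => (hB.hasLaw t.2).hasGaussianLaw)
    (Eventually.of_forall fun ω => hB.zero ω)

lemma memLp (hB : IsContinuousBrownianMotion P T 𝓕 B) {t : ℝ} (ht : t ∈ Icc 0 T) :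
    MemLp (B t) 2 P := (hB.hasLaw ht).hasGaussianLaw.memLp_two

lemma covariance_eq [IsProbabilityMeasure P] (hB : IsContinuousBrownianMotion P T 𝓕 B) {s t : ℝ} (hs : s ∈ Icc 0 T)
    (ht : t ∈ Icc 0 T) : cov[B s, B t; P] = min s t := by
  wlog hst : s ≤ t generalizing s t
  · rw [covariance_comm, this ht hs (le_of_not_ge hst), min_comm]
  have h2 : B t = (fun ω => B t ω - B s ω) + B s := by ext; simp
  have hind : IndepFun (B s) (fun ω => B t ω - B s ω) P := by
    refine Indep.symm (indep_of_indep_of_le_right (hB.indep_increment s t hs.1 hst ht.2) ?_)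
    exact (hB.adapted s hs).comap_le
  rw [h2, covariance_add_right (hB.memLp hs) (hB.memLp_increment hs.1 hst ht.2) (hB.memLp hs),
    hind.covariance_eq_zero (hB.memLp hs) (hB.memLp_increment hs.1 hst ht.2),
    covariance_self (hB.memLp hs).aestronglyMeasurable.aemeasurable, (hB.hasLaw hs).variance_eq,
    variance_id_gaussianReal, min_eq_left hst, Real.coe_toNNReal _ hs.1, zero_add]

end IsContinuousBrownianMotion

end BrownianMotion

/-! ### Splitting off the midpoint height of a Brownian bridge. -/

section Bridge

/-- The tent function on `[s, t]`: it vanishes outside `(s, t)` and has peak `1` at the midpoint. -/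
noncomputable def tent (s t u : ℝ) : ℝ :=
  4 / (t - s) * (min ((s + t) / 2) u - (min s u + min t u) / 2)

lemma continuous_tent (s t : ℝ) : Continuous (tent s t) := by
  unfold tent; fun_prop

lemma tent_eq_zero {s t u : ℝ} (hst : s < t) (hu : u ∉ Ioo s t) : tent s t u = 0 := by
  unfold tent
  rw [mem_Ioo, not_and_or, not_lt, not_lt] at hu
  rcases hu with hu | hu
  · rw [min_eq_right hu, min_eq_right (by linarith), min_eq_right (by linarith)]; ring
  · rw [min_eq_left hu, min_eq_left (by linarith), min_eq_left (by linarith)]; ring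

lemma tent_midpoint {s t : ℝ} (hst : s < t) : tent s t ((s + t) / 2) = 1 := by
  unfold tent
  rw [min_self, min_eq_left (by linarith), min_eq_right (by linarith)]
  have : t - s ≠ 0 := by linarith
  field_simp
  ring

lemma tent_pos {s t u : ℝ} (hu : u ∈ Ioo s t) : 0 < tent s t u := by
  unfold tent
  obtain ⟨h1, h2⟩ := hu
  refine mul_pos (div_pos (by norm_num) (by linarith)) ?_
  rw [min_eq_left h1.le, min_eq_right h2.le]
  rcases min_cases ((s + t) / 2) u with ⟨h, _⟩ | ⟨h, _⟩ <;> rw [h] <;> linarith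

variable {Ω : Type*} {mΩ : MeasurableSpace Ω} {P : Measure Ω} {T : ℝ} {𝓕 : Filtration ℝ mΩ}
  {B : ℝ → Ω → ℝ}

/-- The height of the Brownian bridge on `[s, t]` at the midpoint. -/
noncomputable def bridgeHeight (B : ℝ → Ω → ℝ) (s t : ℝ) (ω : Ω) : ℝ :=
  B ((s + t) / 2) ω - (B s ω + B t ω) / 2

/-- The Brownian path with the contribution of the bridge height on `[s, t]` removed. -/
noncomputable def flattened (B : ℝ → Ω → ℝ) (s t u : ℝ) (ω : Ω) : ℝ :=
  B u ω - bridgeHeight B s t ω * tent s t u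

namespace IsContinuousBrownianMotion

variable {s t : ℝ}

lemma measurable_bridgeHeight (hB : IsContinuousBrownianMotion P T 𝓕 B) :
    Measurable (bridgeHeight B s t) :=
  (hB.measurable _).sub (((hB.measurable _).add (hB.measurable _)).div_const _)

lemma measurable_flattened (hB : IsContinuousBrownianMotion P T 𝓕 B) (u : ℝ) :
    Measurable (flattened B s t u) :=
  (hB.measurable u).sub (hB.measurable_bridgeHeight.mul_const _)

lemma continuous_flattened (hB : IsContinuousBrownianMotion P T 𝓕 B) (ω : Ω) :
    Continuous (fun u => flattened B s t u ω) :=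
  (hB.continuous ω).sub (continuous_const.mul (continuous_tent s t))

/-- By bilinearity the covariance is a combination of minima of times, which is exactly the bracket
in the definition of `tent`. -/
lemma covariance_bridgeHeight_left [IsProbabilityMeasure P]
    (hB : IsContinuousBrownianMotion P T 𝓕 B) (hs : 0 ≤ s)
    (hst : s < t) (ht : t ≤ T) {u : ℝ} (hu : u ∈ Icc 0 T) :
    cov[bridgeHeight B s t, B u; P] = (t - s) / 4 * tent s t u := by
  have ms := hB.memLp (t := s) ⟨hs, by linarith⟩
  have mt := hB.memLp (t := t) ⟨by linarith, ht⟩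
  have mr := hB.memLp (t := (s + t) / 2) ⟨by linarith, by linarith⟩
  have e : bridgeHeight B s t = B ((s + t) / 2) - (2⁻¹ : ℝ) • (B s + B t) := by
    ext ω; simp [bridgeHeight]; ring
  rw [e, covariance_sub_left mr ((ms.add mt).const_smul _) (hB.memLp hu), covariance_smul_left,
    covariance_add_left ms mt (hB.memLp hu), hB.covariance_eq ⟨by linarith, by linarith⟩ hu,
    hB.covariance_eq ⟨by linarith, by linarith⟩ hu, hB.covariance_eq ⟨by linarith, by linarith⟩ hu,
    tent]
  have : t - s ≠ 0 := by linarith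
  field_simp

lemma memLp_bridgeHeight (hB : IsContinuousBrownianMotion P T 𝓕 B) (hs : 0 ≤ s)
    (hst : s < t) (ht : t ≤ T) : MemLp (bridgeHeight B s t) 2 P := by
  have ms := hB.memLp (t := s) ⟨hs, by linarith⟩
  have mt := hB.memLp (t := t) ⟨by linarith, ht⟩
  have mr := hB.memLp (t := (s + t) / 2) ⟨by linarith, by linarith⟩
  have e : bridgeHeight B s t = B ((s + t) / 2) - (2⁻¹ : ℝ) • (B s + B t) := by
    ext ω; simp [bridgeHeight]; ring
  rw [e]
  exact mr.sub ((ms.add mt).const_smul _)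

lemma variance_bridgeHeight [IsProbabilityMeasure P]
    (hB : IsContinuousBrownianMotion P T 𝓕 B) (hs : 0 ≤ s)
    (hst : s < t) (ht : t ≤ T) : Var[bridgeHeight B s t; P] = (t - s) / 4 := by
  have ms := hB.memLp (t := s) ⟨hs, by linarith⟩
  have mt := hB.memLp (t := t) ⟨by linarith, ht⟩
  have mr := hB.memLp (t := (s + t) / 2) ⟨by linarith, by linarith⟩
  have mξ := hB.memLp_bridgeHeight hs hst ht
  have e : bridgeHeight B s t = B ((s + t) / 2) - (2⁻¹ : ℝ) • (B s + B t) := by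
    ext ω; simp [bridgeHeight]; ring
  rw [← covariance_self mξ.aestronglyMeasurable.aemeasurable]
  nth_rw 2 [e]
  rw [covariance_sub_right mξ mr ((ms.add mt).const_smul _), covariance_smul_right,
    covariance_add_right mξ ms mt, hB.covariance_bridgeHeight_left hs hst ht ⟨hs, by linarith⟩,
    hB.covariance_bridgeHeight_left hs hst ht ⟨by linarith, by linarith⟩,
    hB.covariance_bridgeHeight_left hs hst ht ⟨by linarith, by linarith⟩,
    tent_eq_zero hst (u := s) (by simp), tent_eq_zero hst (u := t) (by simp), tent_midpoint hst]
  ring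

/-- Every coordinate is a linear function of at most four values of `B`. Joint Gaussianity of both
families is what turns zero covariance into independence. -/
lemma isGaussianProcess_flattened [IsProbabilityMeasure P]
    (hB : IsContinuousBrownianMotion P T 𝓕 B) (hs : 0 ≤ s)
    (hst : s < t) (ht : t ≤ T) :
    IsGaussianProcess (Sum.elim (fun u : Icc 0 T => flattened B s t u)
      (fun _ : Unit => bridgeHeight B s t)) P := by
  classical
  have : Fact (0 ≤ T) := ⟨by linarith⟩
  let s' : Icc 0 T := ⟨s, hs, by linarith⟩
  let t' : Icc 0 T := ⟨t, by linarith, ht⟩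
  let r' : Icc 0 T := ⟨(s + t) / 2, by linarith, by linarith⟩
  refine hB.isGaussianProcess.of_isGaussianProcess fun u => ?_
  rcases u with u | u
  · refine ⟨{s', t', r', u},
      { toFun := fun x => x ⟨u, by simp⟩ -
          (x ⟨r', by simp⟩ - (x ⟨s', by simp⟩ + x ⟨t', by simp⟩) / 2) * tent s t u
        map_add' := fun x y => by simp only [Pi.add_apply]; ring
        map_smul' := fun c x => by
          simp only [Pi.smul_apply, smul_eq_mul, RingHom.id_apply]; ring
        cont := by fun_prop }, fun ω => rfl⟩
  · refine ⟨{s', t', r'},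
      { toFun := fun x => x ⟨r', by simp⟩ - (x ⟨s', by simp⟩ + x ⟨t', by simp⟩) / 2
        map_add' := fun x y => by simp only [Pi.add_apply]; ring
        map_smul' := fun c x => by
          simp only [Pi.smul_apply, smul_eq_mul, RingHom.id_apply]; ring
        cont := by fun_prop }, fun ω => rfl⟩

/-- The covariance of `B u` with the bridge height is the tent at `u` times the variance of the
height, so subtracting the tent multiple of the height leaves something uncorrelated with it. -/
lemma indepFun_flattened_bridgeHeight [IsProbabilityMeasure P]
    (hB : IsContinuousBrownianMotion P T 𝓕 B) (hs : 0 ≤ s)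
    (hst : s < t) (ht : t ≤ T) :
    IndepFun (fun ω (u : Icc 0 T) => flattened B s t u ω) (bridgeHeight B s t) P := by
  have key := (hB.isGaussianProcess_flattened hs hst ht).indepFun_of_covariance_eq_zero
    (fun u => (hB.measurable_flattened u).aemeasurable)
    (fun _ => hB.measurable_bridgeHeight.aemeasurable) (fun u _ => ?_)
  · exact key.comp (φ := id) (ψ := fun x : Unit → ℝ => x ()) measurable_id (measurable_pi_apply _)
  · have mξ := hB.memLp_bridgeHeight hs hst ht
    have e : flattened B s t u = B u - tent s t u • bridgeHeight B s t := by
      ext ω; simp [flattened]; ring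
    rw [e, covariance_comm, covariance_sub_right mξ (hB.memLp u.2) (mξ.const_smul _),
      covariance_smul_right, hB.covariance_bridgeHeight_left hs hst ht u.2,
      covariance_self mξ.aestronglyMeasurable.aemeasurable, hB.variance_bridgeHeight hs hst ht]
    ring

lemma map_bridgeHeight [IsProbabilityMeasure P]
    (hB : IsContinuousBrownianMotion P T 𝓕 B) (hs : 0 ≤ s)
    (hst : s < t) (ht : t ≤ T) :
    P.map (bridgeHeight B s t) = gaussianReal 0 ((t - s) / 4).toNNReal := by
  have h := (hB.isGaussianProcess_flattened hs hst ht).hasGaussianLaw_eval (Sum.inr ())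
  have h0 : ∫ ω, bridgeHeight B s t ω ∂P = 0 := by
    have z : ∀ u ∈ Icc 0 T, ∫ ω, B u ω ∂P = 0 := fun u hu => by
      rw [(hB.hasLaw hu).integral_eq, integral_id_gaussianReal]
    have i : ∀ u ∈ Icc 0 T, Integrable (B u) P := fun u hu => (hB.memLp hu).integrable (by norm_num)
    have hs' : s ∈ Icc 0 T := ⟨hs, by linarith⟩
    have ht' : t ∈ Icc 0 T := ⟨by linarith, ht⟩
    have hr' : (s + t) / 2 ∈ Icc 0 T := ⟨by linarith, by linarith⟩
    simp only [bridgeHeight]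
    rw [integral_sub (i _ hr') (by exact ((i _ hs').add (i _ ht')).div_const 2), integral_div,
      integral_add (i _ hs') (i _ ht'), z _ hs', z _ ht', z _ hr']
    simp
  have := h.map_eq_gaussianReal
  simp only [Sum.elim_inr] at this
  rw [this, h0, hB.variance_bridgeHeight hs hst ht]

end IsContinuousBrownianMotion

end Bridge

/-! ### Itô's isometry for finite weighted sums of increments. -/

section ItoIsometry

variable {Ω : Type*} {mΩ : MeasurableSpace Ω} {P : Measure Ω} {T : ℝ}
  {𝓕 : Filtration ℝ mΩ} {W : ℝ → Ω → ℝ}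

namespace IsStandardBrownianMotion

lemma indepFun_increment (hW : IsStandardBrownianMotion P T 𝓕 W) {s t : ℝ} (hs : 0 ≤ s)
    (hst : s ≤ t) (ht : t ≤ T) {G : Ω → ℝ} (hG : Measurable[𝓕 s] G) :
    IndepFun G (fun ω => W t ω - W s ω) P :=
  Indep.symm (indep_of_indep_of_le_right (hW.indep_increment s t hs hst ht) hG.comap_le)

lemma integral_mul_increment (hW : IsStandardBrownianMotion P T 𝓕 W) {s t : ℝ} (hs : 0 ≤ s)
    (hst : s ≤ t) (ht : t ≤ T) {G : Ω → ℝ} (hG : Measurable[𝓕 s] G) :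
    ∫ ω, G ω * (W t ω - W s ω) ∂P = 0 := by
  rw [(hW.indepFun_increment hs hst ht hG).integral_fun_mul_eq_mul_integral
    (hG.mono (𝓕.le s) le_rfl).aestronglyMeasurable
    (hW.hasLaw_increment hs hst ht).aemeasurable.aestronglyMeasurable,
    hW.integral_increment hs hst ht, mul_zero]

lemma integral_mul_increment_sq (hW : IsStandardBrownianMotion P T 𝓕 W) {s t : ℝ} (hs : 0 ≤ s)
    (hst : s ≤ t) (ht : t ≤ T) {G : Ω → ℝ} (hG : Measurable[𝓕 s] G) :
    ∫ ω, G ω * (W t ω - W s ω) ^ 2 ∂P = (∫ ω, G ω ∂P) * (t - s) := by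
  have hi : IndepFun G (fun ω => (W t ω - W s ω) ^ 2) P :=
    (hW.indepFun_increment hs hst ht hG).comp (φ := id) (ψ := fun x => x ^ 2) measurable_id
      (by fun_prop)
  rw [hi.integral_fun_mul_eq_mul_integral
    (hG.mono (𝓕.le s) le_rfl).aestronglyMeasurable
    ((hW.hasLaw_increment hs hst ht).aemeasurable.pow_const 2).aestronglyMeasurable,
    hW.integral_increment_sq hs hst ht]

lemma integrable_mul_increment_mul_increment
    (hW : IsStandardBrownianMotion P T 𝓕 W) {a b c d : ℝ} (ha : 0 ≤ a) (hab : a ≤ b) (hb : b ≤ T)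
    (hc : 0 ≤ c) (hcd : c ≤ d) (hd : d ≤ T) {ζ : Ω → ℝ} (hζ : Measurable ζ) {C : ℝ}
    (hC : ∀ ω, |ζ ω| ≤ C) :
    Integrable (fun ω => ζ ω * ((W b ω - W a ω) * (W d ω - W c ω))) P :=
  ((hW.memLp_increment ha hab hb).integrable_mul (hW.memLp_increment hc hcd hd)).bdd_mul
    hζ.aestronglyMeasurable (Eventually.of_forall hC)

/-- Split the first increment at `c`. Its part before `c` is known at time `c` and is orthogonal to
the second increment; on the overlap, splitting at the smaller of `b` and `d` leaves one squared
increment. -/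
lemma integral_mul_increment_mul_increment_of_le
    (hW : IsStandardBrownianMotion P T 𝓕 W) {a b c d : ℝ} (ha : 0 ≤ a) (hab : a ≤ b) (hb : b ≤ T)
    (hcd : c ≤ d) (hd : d ≤ T) (hac : a ≤ c) {ζ : Ω → ℝ} (hζ : Measurable[𝓕 c] ζ) {C : ℝ}
    (hC : ∀ ω, |ζ ω| ≤ C) :
    ∫ ω, ζ ω * ((W b ω - W a ω) * (W d ω - W c ω)) ∂P =
      (∫ ω, ζ ω ∂P) * max (min b d - c) 0 := by
  have hWm : ∀ u v, 0 ≤ u → u ≤ v → v ≤ T → Measurable[𝓕 v] (W u) := fun u v hu huv hv =>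
    (hW.adapted u ⟨hu, huv.trans hv⟩).mono (𝓕.mono huv) le_rfl
  have hc : 0 ≤ c := ha.trans hac
  have hζ' : Measurable ζ := hζ.mono (𝓕.le c) le_rfl
  rcases le_or_gt b c with hbc | hcb
  · rw [max_eq_right (by linarith [min_le_left b d]), mul_zero]
    have := hW.integral_mul_increment hc hcd hd (G := fun ω => ζ ω * (W b ω - W a ω))
      (hζ.mul ((hWm b c (ha.trans hab) hbc (hcd.trans hd)).sub (hWm a c ha hac (hcd.trans hd))))
    simpa [mul_assoc] using this
  · have h0 : ∫ ω, ζ ω * ((W c ω - W a ω) * (W d ω - W c ω)) ∂P = 0 := by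
      have := hW.integral_mul_increment hc hcd hd (G := fun ω => ζ ω * (W c ω - W a ω))
        (hζ.mul ((hWm c c hc le_rfl (hcd.trans hd)).sub (hWm a c ha hac (hcd.trans hd))))
      simpa [mul_assoc] using this
    have h1 : ∫ ω, ζ ω * ((W b ω - W c ω) * (W d ω - W c ω)) ∂P =
        (∫ ω, ζ ω ∂P) * (min b d - c) := by
      rcases le_total b d with hbd | hdb
      · have h2 : ∫ ω, ζ ω * ((W b ω - W c ω) * (W d ω - W b ω)) ∂P = 0 := by
          have := hW.integral_mul_increment (ha.trans hab) hbd hd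
            (G := fun ω => ζ ω * (W b ω - W c ω))
            ((hζ.mono (𝓕.mono hcb.le) le_rfl).mul
              ((hWm b b (ha.trans hab) le_rfl hb).sub (hWm c b hc hcb.le hb)))
          simpa [mul_assoc] using this
        have h3 := hW.integral_mul_increment_sq hc hcb.le hb hζ
        have h4 := integral_add
          (hW.integrable_mul_increment_mul_increment hc hcb.le hb hc hcb.le hb hζ' hC)
          (hW.integrable_mul_increment_mul_increment hc hcb.le hb (ha.trans hab) hbd hd hζ' hC)
        rw [h2, add_zero] at h4
        rw [min_eq_left hbd, ← h3]
        simp_rw [pow_two]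
        rw [← h4]
        congr 1; ext ω; ring
      · have h2 : ∫ ω, ζ ω * ((W d ω - W c ω) * (W b ω - W d ω)) ∂P = 0 := by
          have := hW.integral_mul_increment (hc.trans hcd) hdb hb
            (G := fun ω => ζ ω * (W d ω - W c ω))
            ((hζ.mono (𝓕.mono hcd) le_rfl).mul
              ((hWm d d (hc.trans hcd) le_rfl hd).sub (hWm c d hc hcd hd)))
          simpa [mul_assoc] using this
        have h3 := hW.integral_mul_increment_sq hc hcd hd hζ
        have h4 := integral_add
          (hW.integrable_mul_increment_mul_increment hc hcd hd hc hcd hd hζ' hC)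
          (hW.integrable_mul_increment_mul_increment hc hcd hd (hc.trans hcd) hdb hb hζ' hC)
        rw [h2, add_zero] at h4
        rw [min_eq_right hdb, ← h3]
        simp_rw [pow_two]
        rw [← h4]
        congr 1; ext ω; ring
    have h4 := integral_add
      (hW.integrable_mul_increment_mul_increment ha hac (hcb.le.trans hb) hc hcd hd hζ' hC)
      (hW.integrable_mul_increment_mul_increment hc hcb.le hb hc hcd hd hζ' hC)
    rw [max_eq_left (by rw [sub_nonneg]; exact le_min hcb.le hcd), ← h1,
      ← zero_add (∫ ω, ζ ω * ((W b ω - W c ω) * (W d ω - W c ω)) ∂P), ← h0, ← h4]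
    congr 1; ext ω; ring

lemma integral_mul_increments (hW : IsStandardBrownianMotion P T 𝓕 W) {a b c d : ℝ}
    (ha : 0 ≤ a) (hab : a ≤ b) (hb : b ≤ T) (hc : 0 ≤ c) (hcd : c ≤ d) (hd : d ≤ T)
    {ξ η : Ω → ℝ} (hξ : Measurable[𝓕 a] ξ) (hη : Measurable[𝓕 c] η) {C D : ℝ}
    (hC : ∀ ω, |ξ ω| ≤ C) (hD : ∀ ω, |η ω| ≤ D) :
    ∫ ω, (ξ ω * (W b ω - W a ω)) * (η ω * (W d ω - W c ω)) ∂P =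
      (∫ ω, ξ ω * η ω ∂P) * volume.real (Ioc a b ∩ Ioc c d) := by
  wlog hac : a ≤ c generalizing a b c d ξ η C D
  · have := this hc hcd hd ha hab hb hη hξ hD hC (le_of_not_ge hac)
    rw [inter_comm] at this
    simpa [mul_comm] using this
  have hb' : ∀ ω, |ξ ω * η ω| ≤ C * D := fun ω => by
    rw [abs_mul]
    exact mul_le_mul (hC ω) (hD ω) (abs_nonneg _) ((abs_nonneg _).trans (hC ω))
  have key := hW.integral_mul_increment_mul_increment_of_le ha hab hb hcd hd hac
    ((hξ.mono (𝓕.mono hac) le_rfl).mul hη) hb'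
  rw [Ioc_inter_Ioc, Real.volume_real_Ioc, max_eq_right hac]
  refine Eq.trans ?_ key
  congr 1; ext ω; simp only [Pi.mul_apply]; ring

/-- Itô's isometry for finite sums of weighted increments. -/
lemma isometry (hW : IsStandardBrownianMotion P T 𝓕 W) [IsProbabilityMeasure P] {ι : Type*}
    (u : Finset ι) (a b : ι → ℝ) (ξ : ι → Ω → ℝ) (ha : ∀ i ∈ u, 0 ≤ a i)
    (hab : ∀ i ∈ u, a i ≤ b i) (hb : ∀ i ∈ u, b i ≤ T)
    (hξ : ∀ i ∈ u, Measurable[𝓕 (a i)] (ξ i)) {C : ℝ} (hC : ∀ i ∈ u, ∀ ω, |ξ i ω| ≤ C) :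
    ∫⁻ ω, ‖∑ i ∈ u, ξ i ω * (W (b i) ω - W (a i) ω)‖ₑ ^ 2 ∂P =
      ∫⁻ ω, (∫⁻ s in Icc 0 T,
        ‖∑ i ∈ u, (Ioc (a i) (b i)).indicator (fun _ => ξ i ω) s‖ₑ ^ 2) ∂P := by
  have hξ' : ∀ i ∈ u, Measurable (ξ i) := fun i hi => (hξ i hi).mono (𝓕.le _) le_rfl
  have esq : ∀ x : ℝ, ‖x‖ₑ ^ 2 = ENNReal.ofReal (x ^ 2) := fun x => by
    rw [Real.enorm_eq_ofReal_abs, ← ENNReal.ofReal_pow (abs_nonneg _), sq_abs]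
  have hint : ∀ i ∈ u, ∀ j ∈ u, Integrable (fun ω => (ξ i ω * (W (b i) ω - W (a i) ω)) *
      (ξ j ω * (W (b j) ω - W (a j) ω))) P := fun i hi j hj => by
    have := hW.integrable_mul_increment_mul_increment (ha i hi) (hab i hi) (hb i hi) (ha j hj)
      (hab j hj) (hb j hj) (ζ := fun ω => ξ i ω * ξ j ω) ((hξ' i hi).mul (hξ' j hj))
      (C := C * C) (fun ω => by
        rw [abs_mul]
        exact mul_le_mul (hC i hi ω) (hC j hj ω) (abs_nonneg _) ((abs_nonneg _).trans (hC i hi ω)))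
    exact this.congr (Eventually.of_forall fun ω => by ring)
  have hint2 : ∀ i ∈ u, ∀ j ∈ u, Integrable (fun ω => ξ i ω * ξ j ω) P := fun i hi j hj =>
    (Integrable.of_bound (hξ' j hj).aestronglyMeasurable C (Eventually.of_forall (hC j hj))).bdd_mul
      (hξ' i hi).aestronglyMeasurable (Eventually.of_forall (hC i hi))
  have hvol : ∀ i ∈ u, ∀ j, Ioc (a i) (b i) ∩ Ioc (a j) (b j) ⊆ Icc 0 T :=
    fun i hi j x hx => ⟨(ha i hi).trans hx.1.1.le, hx.1.2.trans (hb i hi)⟩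
  -- Both sides become double sums weighted by the lengths of pairwise intersections. The intervals
  -- may overlap arbitrarily, so processes on different grids need no common refinement.
  have hprod : ∀ ω s, (∑ i ∈ u, (Ioc (a i) (b i)).indicator (fun _ => ξ i ω) s) ^ 2 =
      ∑ i ∈ u, ∑ j ∈ u,
        (Ioc (a i) (b i) ∩ Ioc (a j) (b j)).indicator (fun _ => ξ i ω * ξ j ω) s := by
    intro ω s
    rw [pow_two, Finset.sum_mul_sum]
    refine Finset.sum_congr rfl fun i _ => Finset.sum_congr rfl fun j _ => ?_
    rw [inter_indicator_mul]
  have hiind : ∀ ω, ∀ i ∈ u, ∀ j ∈ u, Integrable (fun s => (Ioc (a i) (b i) ∩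
      Ioc (a j) (b j)).indicator (fun _ => ξ i ω * ξ j ω) s) (volume.restrict (Icc 0 T)) :=
    fun ω i _ j _ => (integrable_const _).indicator (measurableSet_Ioc.inter measurableSet_Ioc)
  have hinner : ∀ ω, (∫⁻ s in Icc 0 T,
      ‖∑ i ∈ u, (Ioc (a i) (b i)).indicator (fun _ => ξ i ω) s‖ₑ ^ 2) =
      ENNReal.ofReal (∑ i ∈ u, ∑ j ∈ u,
        ξ i ω * ξ j ω * volume.real (Ioc (a i) (b i) ∩ Ioc (a j) (b j))) := by
    intro ω
    simp_rw [esq]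
    rw [← ofReal_integral_eq_lintegral_ofReal]
    · congr 1
      simp_rw [hprod]
      rw [integral_finsetSum _ fun i hi => integrable_finsetSum _ fun j hj => hiind ω i hi j hj]
      refine Finset.sum_congr rfl fun i hi => ?_
      rw [integral_finsetSum _ fun j hj => hiind ω i hi j hj]
      refine Finset.sum_congr rfl fun j hj => ?_
      rw [integral_indicator_const _ (measurableSet_Ioc.inter measurableSet_Ioc), smul_eq_mul,
        mul_comm, measureReal_restrict_apply (measurableSet_Ioc.inter measurableSet_Ioc),
        inter_eq_left.2 (hvol i hi j)]
    · simp_rw [hprod]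
      exact integrable_finsetSum _ fun i hi => integrable_finsetSum _ fun j hj => hiind ω i hi j hj
    · exact Eventually.of_forall fun s => sq_nonneg _
  simp_rw [hinner, esq]
  rw [← ofReal_integral_eq_lintegral_ofReal, ← ofReal_integral_eq_lintegral_ofReal]
  · congr 1
    simp_rw [pow_two, Finset.sum_mul_sum]
    rw [integral_finsetSum _ fun i hi => integrable_finsetSum _ fun j hj => hint i hi j hj,
      integral_finsetSum _ fun i hi => integrable_finsetSum _ fun j hj =>
        (hint2 i hi j hj).mul_const _]
    refine Finset.sum_congr rfl fun i hi => ?_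
    rw [integral_finsetSum _ fun j hj => hint i hi j hj,
      integral_finsetSum _ fun j hj => (hint2 i hi j hj).mul_const _]
    refine Finset.sum_congr rfl fun j hj => ?_
    rw [integral_mul_const, hW.integral_mul_increments (ha i hi) (hab i hi) (hb i hi) (ha j hj)
      (hab j hj) (hb j hj) (hξ i hi) (hξ j hj) (hC i hi) (hC j hj)]
  · exact integrable_finsetSum _ fun i hi => integrable_finsetSum _ fun j hj =>
      (hint2 i hi j hj).mul_const _
  · refine Eventually.of_forall fun ω => ?_
    have h0 : 0 ≤ ∫ s in Icc 0 T,
        (∑ i ∈ u, (Ioc (a i) (b i)).indicator (fun _ => ξ i ω) s) ^ 2 :=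
      integral_nonneg fun s => sq_nonneg _
    simp_rw [hprod] at h0
    rw [integral_finsetSum _ fun i hi => integrable_finsetSum _ fun j hj => hiind ω i hi j hj]
      at h0
    refine h0.trans_eq (Finset.sum_congr rfl fun i hi => ?_)
    rw [integral_finsetSum _ fun j hj => hiind ω i hi j hj]
    refine Finset.sum_congr rfl fun j hj => ?_
    rw [integral_indicator_const _ (measurableSet_Ioc.inter measurableSet_Ioc), smul_eq_mul,
      mul_comm, measureReal_restrict_apply (measurableSet_Ioc.inter measurableSet_Ioc),
      inter_eq_left.2 (hvol i hi j)]
  · simp_rw [pow_two, Finset.sum_mul_sum]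
    exact integrable_finsetSum _ fun i hi => integrable_finsetSum _ fun j hj => hint i hi j hj
  · exact Eventually.of_forall fun s => sq_nonneg _

end IsStandardBrownianMotion

end ItoIsometry

/-! ### Contraction property and uniqueness of the Itô integral. -/

section ItoIntegral

lemma enorm_sq_real (x : ℝ) : ‖x‖ₑ ^ 2 = ENNReal.ofReal (x ^ 2) := by
  rw [Real.enorm_eq_ofReal_abs, ← ENNReal.ofReal_pow (abs_nonneg _), sq_abs]

lemma enorm_sub_sq_le (x y z : ℝ) : ‖x - z‖ₑ ^ 2 ≤ 2 * (‖y - x‖ₑ ^ 2 + ‖y - z‖ₑ ^ 2) := by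
  simp_rw [enorm_sq_real]
  rw [← ENNReal.ofReal_add (sq_nonneg _) (sq_nonneg _), ← ENNReal.ofReal_ofNat,
    ← ENNReal.ofReal_mul (by norm_num)]
  refine ENNReal.ofReal_le_ofReal ?_
  nlinarith [sq_nonneg ((y - x) + (y - z))]

lemma lintegral_enorm_sub_sq_le {α : Type*} {mα : MeasurableSpace α} {μ : Measure α}
    (x y z : α → ℝ) (hm : AEMeasurable (fun a => y a - x a) μ) :
    ∫⁻ a, ‖x a - z a‖ₑ ^ 2 ∂μ ≤
      2 * (∫⁻ a, ‖y a - x a‖ₑ ^ 2 ∂μ + ∫⁻ a, ‖y a - z a‖ₑ ^ 2 ∂μ) := by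
  have hm1 : AEMeasurable (fun a => ‖y a - x a‖ₑ ^ 2) μ := hm.enorm.pow_const 2
  rw [← lintegral_add_left' hm1, ← lintegral_const_mul' _ _ (by norm_num)]
  exact lintegral_mono fun a => enorm_sub_sq_le _ _ _

variable {Ω : Type*} {mΩ : MeasurableSpace Ω} {P : Measure Ω} {T : ℝ}
  {𝓕 : Filtration ℝ mΩ} {W B : ℝ → Ω → ℝ}

namespace SimpleProcess

lemma measurable_value (S : SimpleProcess T 𝓕) :
    Measurable (fun p : Ω × ℝ => S.value p.2 p.1) := by
  unfold value
  refine Finset.measurable_sum _ fun i _ => ?_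
  have : (fun p : Ω × ℝ => (Ioc (S.grid i) (S.grid (i + 1))).indicator (fun _ => S.ξ i p.1) p.2) =
      (Prod.snd ⁻¹' Ioc (S.grid i) (S.grid (i + 1))).indicator (fun p : Ω × ℝ => S.ξ i p.1) := by
    ext p; rfl
  rw [this]
  exact (((S.ξ_measurable i).mono (𝓕.le _) le_rfl).comp measurable_fst).indicator
    (measurable_snd measurableSet_Ioc)

lemma measurable_integral (S : SimpleProcess T 𝓕) (hW : IsStandardBrownianMotion P T 𝓕 W)
    {t : ℝ} (ht : t ∈ Icc 0 T) : Measurable (S.integral W t) := by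
  unfold integral
  have hm : ∀ i, Measurable (W (min (S.grid i) t)) := fun i =>
    hW.measurable_of_mem ⟨le_min (S.grid_mem i).1 ht.1, (min_le_right _ _).trans ht.2⟩
  exact Finset.measurable_sum _ fun i _ =>
    ((S.ξ_measurable i).mono (𝓕.le _) le_rfl).mul ((hm _).sub (hm _))

/-- A coefficient whose interval starts after `t` need not be measurable at time `t`, but it
multiplies a zero increment. Replacing it by 0 makes the stopped sum fit `isometry`. -/
lemma integral_eq_sum (S : SimpleProcess T 𝓕) (W : ℝ → Ω → ℝ) (t : ℝ) (ω : Ω) :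
    S.integral W t ω = ∑ i ∈ Finset.range S.n, (if S.grid i ≤ t then S.ξ i ω else 0) *
      (W (min (S.grid (i + 1)) t) ω - W (min (S.grid i) t) ω) := by
  refine Finset.sum_congr rfl fun i _ => ?_
  split_ifs with h
  · rfl
  · have h1 : t ≤ S.grid i := (not_le.1 h).le
    rw [min_eq_right h1, min_eq_right (h1.trans (S.grid_mono i.le_succ))]
    simp

lemma value_stopped (S : SimpleProcess T 𝓕) (t s : ℝ) (ω : Ω) :
    ∑ i ∈ Finset.range S.n, (Ioc (min (S.grid i) t) (min (S.grid (i + 1)) t)).indicator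
      (fun _ => if S.grid i ≤ t then S.ξ i ω else 0) s =
      (Iic t).indicator (fun s => S.value s ω) s := by
  by_cases hs : s ≤ t
  · rw [indicator_of_mem (show s ∈ Iic t from hs)]
    refine Finset.sum_congr rfl fun i _ => ?_
    have hiff : s ∈ Ioc (min (S.grid i) t) (min (S.grid (i + 1)) t) ↔
        s ∈ Ioc (S.grid i) (S.grid (i + 1)) := by
      simp only [mem_Ioc, min_lt_iff, le_min_iff]
      constructor
      · rintro ⟨h1 | h1, h2, -⟩
        · exact ⟨h1, h2⟩
        · exact absurd hs (not_le.2 h1)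
      · rintro ⟨h1, h2⟩
        exact ⟨Or.inl h1, h2, hs⟩
    by_cases h : s ∈ Ioc (S.grid i) (S.grid (i + 1))
    · rw [indicator_of_mem (hiff.2 h), indicator_of_mem h, if_pos (h.1.le.trans hs)]
    · rw [indicator_of_notMem (hiff.not.2 h), indicator_of_notMem h]
  · rw [indicator_of_notMem (show s ∉ Iic t from hs)]
    refine Finset.sum_eq_zero fun i _ => indicator_of_notMem ?_ _
    exact fun h => hs (h.2.trans (min_le_right _ _))

/-- The Itô integral is a contraction on simple processes. -/
lemma lintegral_integral_sub_le [IsProbabilityMeasure P] (S S' : SimpleProcess T 𝓕)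
    (hW : IsStandardBrownianMotion P T 𝓕 W) {t : ℝ} (ht : t ∈ Icc 0 T) :
    ∫⁻ ω, ‖S.integral W t ω - S'.integral W t ω‖ₑ ^ 2 ∂P ≤
      ∫⁻ ω, (∫⁻ s in Icc 0 T, ‖S.value s ω - S'.value s ω‖ₑ ^ 2) ∂P := by
  obtain ⟨C, hC⟩ := S.ξ_bounded
  obtain ⟨C', hC'⟩ := S'.ξ_bounded
  have hm : ∀ (R : SimpleProcess T 𝓕) i, Measurable[𝓕 (min (R.grid i) t)]
      (fun ω => if R.grid i ≤ t then R.ξ i ω else 0) := by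
    intro R i
    split_ifs with h
    · rw [min_eq_left h]; exact R.ξ_measurable i
    · exact measurable_const
  have hb : ∀ (R : SimpleProcess T 𝓕) D, (∀ i ω, |R.ξ i ω| ≤ D) → ∀ i ω,
      |if R.grid i ≤ t then R.ξ i ω else 0| ≤ D := by
    intro R D hD i ω
    split_ifs
    · exact hD i ω
    · simpa using (abs_nonneg _).trans (hD i ω)
  -- The difference of the two integrals is a single sum over the disjoint union of the index sets,
  -- with a sign on the second part.
  have key := hW.isometry ((Finset.range S.n).disjSum (Finset.range S'.n))
    (Sum.elim (fun i => min (S.grid i) t) (fun i => min (S'.grid i) t))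
    (Sum.elim (fun i => min (S.grid (i + 1)) t) (fun i => min (S'.grid (i + 1)) t))
    (Sum.elim (fun i ω => if S.grid i ≤ t then S.ξ i ω else 0)
      (fun i ω => - if S'.grid i ≤ t then S'.ξ i ω else 0))
    (by rintro (i | i) -
        · exact le_min (S.grid_mem i).1 ht.1
        · exact le_min (S'.grid_mem i).1 ht.1)
    (by rintro (i | i) -
        · exact min_le_min_right _ (S.grid_mono i.le_succ)
        · exact min_le_min_right _ (S'.grid_mono i.le_succ))
    (by rintro (i | i) - <;> exact (min_le_right _ _).trans ht.2)
    (by rintro (i | i) -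
        · exact hm S i
        · exact (hm S' i).neg)
    (C := max C C')
    (by rintro (i | i) - ω
        · exact (hb S C hC i ω).trans (le_max_left _ _)
        · simp only [Sum.elim_inr, abs_neg]
          exact (hb S' C' hC' i ω).trans (le_max_right _ _))
  simp only [Finset.sum_disjSum, Sum.elim_inl, Sum.elim_inr, neg_mul, Finset.sum_neg_distrib,
    ← sub_eq_add_neg, ← integral_eq_sum] at key
  rw [key]
  refine lintegral_mono fun ω => lintegral_mono fun s => ?_
  have hneg : ∀ i, (Ioc (min (S'.grid i) t) (min (S'.grid (i + 1)) t)).indicator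
      (fun _ => - if S'.grid i ≤ t then S'.ξ i ω else 0) s =
      - (Ioc (min (S'.grid i) t) (min (S'.grid (i + 1)) t)).indicator
      (fun _ => if S'.grid i ≤ t then S'.ξ i ω else 0) s := fun i => by
    rw [indicator_apply, indicator_apply]
    split_ifs <;> simp
  simp only [hneg, Finset.sum_neg_distrib, ← sub_eq_add_neg, value_stopped]
  by_cases hs : s ≤ t
  · rw [indicator_of_mem (show s ∈ Iic t from hs), indicator_of_mem (show s ∈ Iic t from hs)]
  · rw [indicator_of_notMem (show s ∉ Iic t from hs), indicator_of_notMem (show s ∉ Iic t from hs)]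
    simp

end SimpleProcess

/-- Two Itô integrals of the same deterministic integrand agree. -/
lemma IsItoIntegral.ae_eq [IsProbabilityMeasure P] (hW : IsStandardBrownianMotion P T 𝓕 W)
    {φ : ℝ → ℝ} (hφ : Measurable φ) {H H' I I' : ℝ → Ω → ℝ}
    (hH : ∀ᵐ ω ∂P, ∀ s ∈ Icc 0 T, H s ω = φ s) (hH' : ∀ᵐ ω ∂P, ∀ s ∈ Icc 0 T, H' s ω = φ s)
    (hI : IsItoIntegral P T 𝓕 W H I) (hI' : IsItoIntegral P T 𝓕 W H' I') {t : ℝ}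
    (ht : t ∈ Icc 0 T) (hIm : AEMeasurable (I t) P) (hIm' : AEMeasurable (I' t) P) :
    I t =ᵐ[P] I' t := by
  obtain ⟨S, hS1, hS2⟩ := hI
  obtain ⟨S', hS1', hS2'⟩ := hI'
  have hrep : ∀ (R : SimpleProcess T 𝓕) (H : ℝ → Ω → ℝ), (∀ᵐ ω ∂P, ∀ s ∈ Icc 0 T, H s ω = φ s) →
      ∫⁻ ω, (∫⁻ s in Icc 0 T, ‖R.value s ω - H s ω‖ₑ ^ 2) ∂P =
      ∫⁻ ω, (∫⁻ s in Icc 0 T, ‖R.value s ω - φ s‖ₑ ^ 2) ∂P := by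
    intro R H hH
    refine lintegral_congr_ae ?_
    filter_upwards [hH] with ω hω
    exact setLIntegral_congr_fun measurableSet_Icc fun s hs => by simp only [hω s hs]
  simp only [hrep _ H hH] at hS1
  simp only [hrep _ H' hH'] at hS1'
  have hm : ∀ R : SimpleProcess T 𝓕, Measurable (fun p : Ω × ℝ => ‖R.value p.2 p.1 - φ p.2‖ₑ ^ 2) :=
    fun R => ((R.measurable_value.sub (hφ.comp measurable_snd)).enorm).pow_const 2
  -- Pass from I to I' through the integrals of the two approximating simple processes, whose
  -- distance the contraction bounds by their distances to φ. The right side tends to 0.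
  have hle : ∀ k, ∫⁻ ω, ‖I t ω - I' t ω‖ₑ ^ 2 ∂P ≤
      2 * (∫⁻ ω, ‖(S k).integral W t ω - I t ω‖ₑ ^ 2 ∂P +
        2 * (2 * (∫⁻ ω, (∫⁻ s in Icc 0 T, ‖(S k).value s ω - φ s‖ₑ ^ 2) ∂P +
            ∫⁻ ω, (∫⁻ s in Icc 0 T, ‖(S' k).value s ω - φ s‖ₑ ^ 2) ∂P) +
          ∫⁻ ω, ‖(S' k).integral W t ω - I' t ω‖ₑ ^ 2 ∂P)) := by
    intro k
    have h1 := lintegral_enorm_sub_sq_le (μ := P) (I t) ((S k).integral W t) (I' t)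
      (((S k).measurable_integral hW ht).aemeasurable.sub hIm)
    have h2 := lintegral_enorm_sub_sq_le (μ := P) ((S k).integral W t) ((S' k).integral W t) (I' t)
      (((S' k).measurable_integral hW ht).sub ((S k).measurable_integral hW ht)).aemeasurable
    simp_rw [enorm_sub_rev ((S' k).integral W t _) ((S k).integral W t _)] at h2
    have h3 : ∫⁻ ω, (∫⁻ s in Icc 0 T, ‖(S k).value s ω - (S' k).value s ω‖ₑ ^ 2) ∂P ≤
        2 * (∫⁻ ω, (∫⁻ s in Icc 0 T, ‖(S k).value s ω - φ s‖ₑ ^ 2) ∂P +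
            ∫⁻ ω, (∫⁻ s in Icc 0 T, ‖(S' k).value s ω - φ s‖ₑ ^ 2) ∂P) := by
      have hm1 : Measurable (fun ω => ∫⁻ s in Icc 0 T, ‖(S k).value s ω - φ s‖ₑ ^ 2) :=
        Measurable.lintegral_prod_right' (f := fun p : Ω × ℝ => ‖(S k).value p.2 p.1 - φ p.2‖ₑ ^ 2)
          (hm (S k))
      rw [← lintegral_add_left hm1, ← lintegral_const_mul' _ _ (by norm_num)]
      refine lintegral_mono fun ω => ?_
      have hm2 : Measurable (fun s => φ s - (S k).value s ω) :=
        hφ.sub ((S k).measurable_value.comp measurable_prodMk_left)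
      refine (lintegral_enorm_sub_sq_le (fun s => (S k).value s ω) φ (fun s => (S' k).value s ω)
        hm2.aemeasurable).trans_eq ?_
      simp_rw [enorm_sub_rev (φ _)]
    have h4 := (S k).lintegral_integral_sub_le (S' k) hW ht
    refine h1.trans ?_
    gcongr
    refine h2.trans ?_
    gcongr
    exact h4.trans h3
  have hlim : Tendsto (fun k => 2 * (∫⁻ ω, ‖(S k).integral W t ω - I t ω‖ₑ ^ 2 ∂P +
        2 * (2 * (∫⁻ ω, (∫⁻ s in Icc 0 T, ‖(S k).value s ω - φ s‖ₑ ^ 2) ∂P +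
            ∫⁻ ω, (∫⁻ s in Icc 0 T, ‖(S' k).value s ω - φ s‖ₑ ^ 2) ∂P) +
          ∫⁻ ω, ‖(S' k).integral W t ω - I' t ω‖ₑ ^ 2 ∂P))) atTop
      (𝓝 (2 * (0 + 2 * (2 * (0 + 0) + 0)))) := by
    have two : (2 : ℝ≥0∞) ≠ ∞ := by norm_num
    exact ENNReal.Tendsto.const_mul ((hS2 t ht).add (ENNReal.Tendsto.const_mul
      ((ENNReal.Tendsto.const_mul (hS1.add hS1') (Or.inr two)).add (hS2' t ht)) (Or.inr two)))
      (Or.inr two)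
  have h0 : ∫⁻ ω, ‖I t ω - I' t ω‖ₑ ^ 2 ∂P = 0 := by
    refine le_antisymm ?_ bot_le
    have := ge_of_tendsto' hlim hle
    simpa using this
  have hm1 : AEMeasurable (fun ω => ‖I t ω - I' t ω‖ₑ ^ 2) P := (hIm.sub hIm').enorm.pow_const 2
  rw [lintegral_eq_zero_iff' hm1] at h0
  filter_upwards [h0] with ω hω
  have : ‖I t ω - I' t ω‖ₑ = 0 := by simpa using hω
  rwa [enorm_eq_zero, sub_eq_zero] at this

/-- Itô integrals with respect to indistinguishable integrators agree. -/
lemma IsItoIntegral.congr {H H' I I' : ℝ → Ω → ℝ} (hI : IsItoIntegral P T 𝓕 W H I)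
    (hWB : ∀ᵐ ω ∂P, ∀ t ∈ Icc 0 T, B t ω = W t ω)
    (hH : ∀ᵐ ω ∂P, ∀ t ∈ Icc 0 T, H' t ω = H t ω)
    (hII : ∀ t ∈ Icc 0 T, ∀ᵐ ω ∂P, I' t ω = I t ω) : IsItoIntegral P T 𝓕 B H' I' := by
  obtain ⟨S, h1, h2⟩ := hI
  refine ⟨S, ?_, fun t ht => ?_⟩
  · convert h1 using 2 with k
    refine lintegral_congr_ae ?_
    filter_upwards [hH] with ω hω
    exact setLIntegral_congr_fun measurableSet_Icc fun s hs => by simp only [hω s hs]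
  · convert h2 t ht using 2 with k
    refine lintegral_congr_ae ?_
    filter_upwards [hWB, hII t ht] with ω hω hω'
    have hmin : ∀ i, B (min ((S k).grid i) t) ω = W (min ((S k).grid i) t) ω := fun i =>
      hω _ ⟨le_min ((S k).grid_mem i).1 ht.1, (min_le_right _ _).trans ht.2⟩
    simp only [SimpleProcess.integral, hmin, hω']

end ItoIntegral

/-! ### Itô integrals of deterministic integrands by parts. -/

section DeterministicIntegrand

/-- The uniform grid of mesh `T / (k + 1)`, constant after `T`. -/
noncomputable def uniformGrid (T : ℝ) (k i : ℕ) : ℝ := min (i * (T / (k + 1))) T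

lemma uniformGrid_mono {T : ℝ} (hT : 0 < T) (k : ℕ) : Monotone (uniformGrid T k) := by
  intro i j hij
  unfold uniformGrid
  have : (i : ℝ) ≤ j := by exact_mod_cast hij
  gcongr

lemma uniformGrid_mem {T : ℝ} (hT : 0 < T) (k i : ℕ) : uniformGrid T k i ∈ Icc 0 T :=
  ⟨le_min (by positivity) hT.le, min_le_right _ _⟩

lemma uniformGrid_zero {T : ℝ} (hT : 0 < T) (k : ℕ) : uniformGrid T k 0 = 0 := by
  simp [uniformGrid, hT.le]

lemma uniformGrid_last (T : ℝ) (k : ℕ) : uniformGrid T k (k + 1) = T := by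
  have : ((k : ℝ) + 1) * (T / (k + 1)) = T := by field_simp
  simp [uniformGrid, this]

lemma uniformGrid_succ_le {T : ℝ} (hT : 0 < T) (k i : ℕ) :
    uniformGrid T k (i + 1) ≤ uniformGrid T k i + T / (k + 1) := by
  unfold uniformGrid
  have h : 0 < T / (k + 1) := by positivity
  rcases le_total (i * (T / (k + 1))) T with h1 | h1
  · rw [min_eq_left h1]
    refine (min_le_left _ _).trans (le_of_eq ?_)
    push_cast; ring
  · rw [min_eq_right h1]
    exact (min_le_right _ _).trans (by linarith)

lemma sum_indicator_uniformGrid {T : ℝ} (hT : 0 < T) (k : ℕ) {s : ℝ} (hs : s ∈ Ioc 0 T) :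
    ∑ i ∈ Finset.range (k + 1),
      (Ioc (uniformGrid T k i) (uniformGrid T k (i + 1))).indicator (fun _ => (1 : ℝ)) s = 1 := by
  have h : ∀ i, (Ioc (uniformGrid T k i) (uniformGrid T k (i + 1))).indicator
      (fun _ => (1 : ℝ)) s = (Ioi (uniformGrid T k i)).indicator (fun _ => (1 : ℝ)) s -
        (Ioi (uniformGrid T k (i + 1))).indicator (fun _ => (1 : ℝ)) s := by
    intro i
    have := uniformGrid_mono hT k i.le_succ
    by_cases h1 : uniformGrid T k i < s <;> by_cases h2 : s ≤ uniformGrid T k (i + 1)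
    · simp [h1, h2]
    · simp [h1, h2, not_le.1 h2]
    · simp [h1, h2]
    · exact absurd ((not_le.1 h2).trans_le' this) h1
  simp_rw [h]
  rw [Finset.sum_range_sub', uniformGrid_zero hT, uniformGrid_last]
  simp [hs.1, hs.2]

variable {Ω : Type*} {mΩ : MeasurableSpace Ω} {P : Measure Ω} {T : ℝ}
  {𝓕 : Filtration ℝ mΩ} {B : ℝ → Ω → ℝ}

/-- The left-point discretization of a deterministic integrand. -/
noncomputable def leftPointProcess (𝓕 : Filtration ℝ mΩ) (hT : 0 < T) {φ : ℝ → ℝ} {C : ℝ}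
    (hC : ∀ x ∈ Icc 0 T, |φ x| ≤ C) (k : ℕ) : SimpleProcess T 𝓕 where
  n := k + 1
  grid := uniformGrid T k
  grid_mono := uniformGrid_mono hT k
  grid_mem := uniformGrid_mem hT k
  ξ i _ := φ (uniformGrid T k i)
  ξ_measurable _ := measurable_const
  ξ_bounded := ⟨C, fun i _ => hC _ (uniformGrid_mem hT k i)⟩

/-- The cell indicators form a partition of unity on (0, T], so the error is an average of
differences of φ over distances at most the mesh. -/
lemma abs_leftPointProcess_value_sub_le (hT : 0 < T) {φ : ℝ → ℝ} {C L : ℝ}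
    (hC : ∀ x ∈ Icc 0 T, |φ x| ≤ C)
    (hL : ∀ x ∈ Icc 0 T, ∀ y ∈ Icc 0 T, |φ x - φ y| ≤ L * |x - y|) (hL0 : 0 ≤ L) (k : ℕ)
    {s : ℝ} (hs : s ∈ Ioc 0 T) (ω : Ω) :
    |(leftPointProcess 𝓕 hT hC k).value s ω - φ s| ≤ L * (T / (k + 1)) := by
  have h1 := sum_indicator_uniformGrid hT k hs
  have e : (leftPointProcess 𝓕 hT hC k).value s ω - φ s = ∑ i ∈ Finset.range (k + 1),
      (Ioc (uniformGrid T k i) (uniformGrid T k (i + 1))).indicator (fun _ => (1 : ℝ)) s *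
        (φ (uniformGrid T k i) - φ s) := by
    simp_rw [mul_sub]
    rw [Finset.sum_sub_distrib, ← Finset.sum_mul, h1, one_mul]
    congr 1
    refine Finset.sum_congr rfl fun i _ => ?_
    simp [leftPointProcess, indicator_apply]
  have e2 : L * (T / (k + 1)) = ∑ i ∈ Finset.range (k + 1),
      (Ioc (uniformGrid T k i) (uniformGrid T k (i + 1))).indicator (fun _ => (1 : ℝ)) s *
        (L * (T / (k + 1))) := by rw [← Finset.sum_mul, h1, one_mul]
  rw [e, e2]
  refine (Finset.abs_sum_le_sum_abs _ _).trans (Finset.sum_le_sum fun i _ => ?_)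
  by_cases h : s ∈ Ioc (uniformGrid T k i) (uniformGrid T k (i + 1))
  · rw [indicator_of_mem h, one_mul, one_mul]
    refine (hL _ (uniformGrid_mem hT k i) s ⟨hs.1.le, hs.2⟩).trans ?_
    refine mul_le_mul_of_nonneg_left ?_ hL0
    rw [abs_sub_comm, abs_of_nonneg (by linarith [h.1])]
    linarith [h.2, uniformGrid_succ_le hT k i]
  · rw [indicator_of_notMem h]; simp

lemma lintegral_lintegral_enorm_sq_le [IsProbabilityMeasure P] {K : ℝ}
    {F : Ω → ℝ → ℝ} (hF : ∀ ω, ∀ s ∈ Ioc 0 T, |F ω s| ≤ K) :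
    ∫⁻ ω, (∫⁻ s in Icc 0 T, ‖F ω s‖ₑ ^ 2) ∂P ≤ ENNReal.ofReal (K ^ 2 * T) := by
  have hin : ∀ ω, (∫⁻ s in Icc 0 T, ‖F ω s‖ₑ ^ 2) ≤ ENNReal.ofReal (K ^ 2 * T) := by
    intro ω
    rw [← Measure.restrict_congr_set (Ioc_ae_eq_Icc (a := (0 : ℝ)) (b := T) (μ := volume))]
    have : (∫⁻ s in Ioc 0 T, ‖F ω s‖ₑ ^ 2) ≤ ∫⁻ s in Ioc 0 T, ENNReal.ofReal (K ^ 2) := by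
      refine setLIntegral_mono measurable_const fun s hs => ?_
      rw [enorm_sq_real]
      refine ENNReal.ofReal_le_ofReal ?_
      rw [← sq_abs]
      exact pow_le_pow_left₀ (abs_nonneg _) (hF ω s hs) 2
    refine this.trans_eq ?_
    rw [setLIntegral_const, Real.volume_Ioc, ← ENNReal.ofReal_mul (sq_nonneg _), sub_zero]
  refine (lintegral_mono hin).trans_eq ?_
  simp

/-- Integration by parts for the left-point discretizations, along one path. -/
lemma tendsto_leftPointProcess_integral (hB : IsContinuousBrownianMotion P T 𝓕 B) (hT : 0 < T)
    {φ : ℝ → ℝ} (hφ : ContDiff ℝ 1 φ) {C L : ℝ} (hC : ∀ x ∈ Icc 0 T, |φ x| ≤ C)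
    (hL : ∀ x ∈ Icc 0 T, |deriv φ x| ≤ L) {t : ℝ} (ht : t ∈ Icc 0 T) (ω : Ω) :
    Tendsto (fun k => (leftPointProcess 𝓕 hT hC k).integral B t ω) atTop
      (𝓝 (φ t * B t ω - ∫ s in (0 : ℝ)..t, deriv φ s * B s ω)) := by
  have hL0 : 0 ≤ L := (abs_nonneg _).trans (hL 0 ⟨le_rfl, hT.le⟩)
  have hBc := hB.continuous ω
  have hdc : Continuous (deriv φ) := hφ.continuous_deriv le_rfl
  have hii : ∀ a b, IntervalIntegrable (fun s => deriv φ s * B s ω) volume a b := fun a b =>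
    (hdc.mul hBc).intervalIntegrable a b
  -- A quantitative form: ε is any bound for the oscillation of the path over one mesh width.
  have key : ∀ (k : ℕ) (ε : ℝ), (∀ x ∈ Icc 0 T, ∀ y ∈ Icc 0 T, |x - y| ≤ T / (k + 1) →
      |B x ω - B y ω| ≤ ε) → |(leftPointProcess 𝓕 hT hC k).integral B t ω -
        (φ t * B t ω - ∫ s in (0 : ℝ)..t, deriv φ s * B s ω)| ≤ L * ε * T := by
    intro k ε hε
    set p : ℕ → ℝ := fun i => min (uniformGrid T k i) t with hp
    have hp0 : p 0 = 0 := by simp [hp, uniformGrid_zero hT, ht.1]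
    have hpn : p (k + 1) = t := by simp [hp, uniformGrid_last, ht.2]
    have hpm : Monotone p := fun i j hij => min_le_min_right _ (uniformGrid_mono hT k hij)
    have hpmem : ∀ i, p i ∈ Icc 0 T := fun i =>
      ⟨le_min (uniformGrid_mem hT k i).1 ht.1, (min_le_right _ _).trans ht.2⟩
    have hpsucc : ∀ i, p (i + 1) ≤ p i + T / (k + 1) := by
      intro i
      have h0 : 0 < T / (k + 1) := by positivity
      rw [hp]
      simp only
      rw [min_add]
      exact min_le_min (uniformGrid_succ_le hT k i) (by linarith)
    have hform : φ t * B t ω - ∫ s in (0 : ℝ)..t, deriv φ s * B s ω =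
        ∑ i ∈ Finset.range (k + 1), (φ (p (i + 1)) * B (p (i + 1)) ω - φ (p i) * B (p i) ω -
          ∫ s in p i..p (i + 1), deriv φ s * B s ω) := by
      rw [Finset.sum_sub_distrib, Finset.sum_range_sub (fun i => φ (p i) * B (p i) ω),
        intervalIntegral.sum_integral_adjacent_intervals fun i _ => hii _ _, hp0, hpn, hB.zero]
      simp
    have hint : (leftPointProcess 𝓕 hT hC k).integral B t ω =
        ∑ i ∈ Finset.range (k + 1), φ (p i) * (B (p (i + 1)) ω - B (p i) ω) := by
      refine Finset.sum_congr rfl fun i _ => ?_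
      change φ (uniformGrid T k i) * (B (p (i + 1)) ω - B (p i) ω) = _
      rcases le_total (uniformGrid T k i) t with h | h
      · simp only [hp]; rw [min_eq_left h]
      · have h1 : p i = t := min_eq_right h
        have h2 : p (i + 1) = t := min_eq_right (h.trans (uniformGrid_mono hT k i.le_succ))
        rw [h1, h2]; simp
    -- Integration by parts on one cell: writing the increment of φ as ∫ φ' leaves only the
    -- oscillation of the path within the cell.
    have hterm : ∀ i, φ (p i) * (B (p (i + 1)) ω - B (p i) ω) -
        (φ (p (i + 1)) * B (p (i + 1)) ω - φ (p i) * B (p i) ω -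
          ∫ s in p i..p (i + 1), deriv φ s * B s ω) =
        ∫ s in p i..p (i + 1), deriv φ s * (B s ω - B (p (i + 1)) ω) := by
      intro i
      have hFTC : ∫ s in p i..p (i + 1), deriv φ s = φ (p (i + 1)) - φ (p i) :=
        intervalIntegral.integral_deriv_eq_sub (fun x _ => hφ.differentiable one_ne_zero x)
          (hdc.intervalIntegrable _ _)
      simp_rw [mul_sub]
      rw [intervalIntegral.integral_sub (hii _ _)
        ((hdc.intervalIntegrable _ _).mul_const _),
        intervalIntegral.integral_mul_const, hFTC]
      ring
    rw [hint, hform, ← Finset.sum_sub_distrib]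
    simp_rw [hterm]
    have hbound : ∀ i, |∫ s in p i..p (i + 1), deriv φ s * (B s ω - B (p (i + 1)) ω)| ≤
        L * ε * (p (i + 1) - p i) := by
      intro i
      have h := intervalIntegral.norm_integral_le_of_norm_le_const
        (a := p i) (b := p (i + 1)) (f := fun s => deriv φ s * (B s ω - B (p (i + 1)) ω))
        (C := L * ε) fun s hs => ?_
      · rwa [abs_of_nonneg (sub_nonneg.2 (hpm i.le_succ))] at h
      · rw [uIoc_of_le (hpm i.le_succ)] at hs
        have hsT : s ∈ Icc 0 T := ⟨(hpmem i).1.trans hs.1.le, hs.2.trans (hpmem (i + 1)).2⟩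
        rw [norm_mul]
        refine mul_le_mul (hL s hsT) (hε s hsT _ (hpmem (i + 1)) ?_) (norm_nonneg _) hL0
        rw [abs_sub_comm, abs_of_nonneg (sub_nonneg.2 hs.2)]
        linarith [hs.1, hpsucc i]
    have hε0 : 0 ≤ ε := by
      simpa using hε 0 ⟨le_rfl, hT.le⟩ 0 ⟨le_rfl, hT.le⟩ (by simp; positivity)
    calc |∑ i ∈ Finset.range (k + 1), ∫ s in p i..p (i + 1), deriv φ s * (B s ω - B (p (i + 1)) ω)|
        ≤ ∑ i ∈ Finset.range (k + 1), L * ε * (p (i + 1) - p i) :=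
          (Finset.abs_sum_le_sum_abs _ _).trans (Finset.sum_le_sum fun i _ => hbound i)
      _ = L * ε * t := by rw [← Finset.mul_sum, Finset.sum_range_sub p, hp0, hpn, sub_zero]
      _ ≤ L * ε * T := by gcongr; exact ht.2
  rw [Metric.tendsto_atTop]
  intro ε hε
  have hpos : 0 < ε / (L * T + 1) := by positivity
  have huc := isCompact_Icc.uniformContinuousOn_of_continuous (hBc.continuousOn (s := Icc 0 T))
  obtain ⟨η, hη, hηB⟩ := Metric.uniformContinuousOn_iff_le.1 huc _ hpos
  have hmesh : Tendsto (fun k : ℕ => T / ((k : ℝ) + 1)) atTop (𝓝 0) :=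
    tendsto_const_div_atTop_nhds_zero_nat T |>.comp (tendsto_add_atTop_nat 1) |>.congr
      fun k => by simp
  obtain ⟨N, hN⟩ := eventually_atTop.1 (hmesh.eventually (gt_mem_nhds hη))
  refine ⟨N, fun k hk => ?_⟩
  rw [Real.dist_eq]
  refine (key k _ fun x hx y hy hxy => hηB x hx y hy (hxy.trans (hN k hk).le)).trans_lt ?_
  rw [mul_div_assoc', div_mul_eq_mul_div, div_lt_iff₀ (by positivity)]
  nlinarith

/-- The Itô integral of a `C¹` deterministic integrand, by parts. -/
lemma isItoIntegral_of_contDiff [IsProbabilityMeasure P]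
    (hB : IsContinuousBrownianMotion P T 𝓕 B) (hT : 0 < T) {φ : ℝ → ℝ} (hφ : ContDiff ℝ 1 φ) :
    IsItoIntegral P T 𝓕 B (fun s _ => φ s)
      (fun t ω => φ t * B t ω - ∫ s in (0 : ℝ)..t, deriv φ s * B s ω) := by
  obtain ⟨C, hC⟩ := isCompact_Icc.exists_bound_of_continuousOn
    (hφ.continuous.continuousOn (s := Icc 0 T))
  obtain ⟨L, hL⟩ := isCompact_Icc.exists_bound_of_continuousOn
    ((hφ.continuous_deriv le_rfl).continuousOn (s := Icc 0 T))
  simp only [Real.norm_eq_abs] at hC hL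
  have hL0 : 0 ≤ L := (abs_nonneg _).trans (hL 0 ⟨le_rfl, hT.le⟩)
  have hLip : ∀ x ∈ Icc 0 T, ∀ y ∈ Icc 0 T, |φ x - φ y| ≤ L * |x - y| := fun x hx y hy =>
    Convex.norm_image_sub_le_of_norm_deriv_le (s := Icc 0 T)
      (fun z _ => hφ.differentiable one_ne_zero z) hL (convex_Icc 0 T) hy hx
  have hval := fun (k : ℕ) (s : ℝ) (hs : s ∈ Ioc 0 T) (ω : Ω) =>
    abs_leftPointProcess_value_sub_le (𝓕 := 𝓕) hT hC hLip hL0 k hs ω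
  have hmesh : Tendsto (fun k : ℕ => T / ((k : ℝ) + 1)) atTop (𝓝 0) :=
    tendsto_const_div_atTop_nhds_zero_nat T |>.comp (tendsto_add_atTop_nat 1) |>.congr
      fun k => by simp
  have hlim : ∀ c : ℝ, Tendsto (fun k : ℕ => ENNReal.ofReal ((c * (T / ((k : ℝ) + 1))) ^ 2 * T))
      atTop (𝓝 0) := fun c => by
    have := ENNReal.tendsto_ofReal (((hmesh.const_mul c).pow 2).mul_const T)
    simpa using this
  refine ⟨leftPointProcess 𝓕 hT hC, ?_, fun t ht => ?_⟩
  · exact tendsto_of_tendsto_of_tendsto_of_le_of_le tendsto_const_nhds (hlim L)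
      (fun _ => bot_le) fun k => lintegral_lintegral_enorm_sq_le fun ω s hs => hval k s hs ω
  · refine tendsto_of_tendsto_of_tendsto_of_le_of_le tendsto_const_nhds (hlim (2 * L))
      (fun _ => bot_le) fun k => ?_
    have hmeas : ∀ m, Measurable (fun ω => ‖(leftPointProcess 𝓕 hT hC k).integral B t ω -
        (leftPointProcess 𝓕 hT hC m).integral B t ω‖ₑ ^ 2) := fun m =>
      ((SimpleProcess.measurable_integral _ hB.toIsStandardBrownianMotion ht).sub
        (SimpleProcess.measurable_integral _ hB.toIsStandardBrownianMotion ht)).enorm.pow_const 2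
    -- Pathwise convergence is upgraded to L² by Fatou's lemma in m: the contraction bounds the
    -- distance of the k-th and m-th integrals uniformly in m ≥ k.
    have hpt : ∀ ω, ‖(leftPointProcess 𝓕 hT hC k).integral B t ω -
        (φ t * B t ω - ∫ s in (0 : ℝ)..t, deriv φ s * B s ω)‖ₑ ^ 2 =
        liminf (fun m => ‖(leftPointProcess 𝓕 hT hC k).integral B t ω -
        (leftPointProcess 𝓕 hT hC m).integral B t ω‖ₑ ^ 2) atTop := fun ω => by
      have hten := tendsto_leftPointProcess_integral hB hT hφ hC hL ht ω
      have h2 := (((tendsto_const_nhds (x := (leftPointProcess 𝓕 hT hC k).integral B t ω)).sub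
        hten).enorm)
      exact (((ENNReal.continuous_pow 2).tendsto _).comp h2).liminf_eq.symm
    simp_rw [hpt]
    refine (lintegral_liminf_le hmeas).trans ?_
    refine liminf_le_of_frequently_le' (Eventually.frequently ?_)
    filter_upwards [eventually_ge_atTop k] with m hm
    refine (SimpleProcess.lintegral_integral_sub_le _ _ hB.toIsStandardBrownianMotion ht).trans ?_
    refine lintegral_lintegral_enorm_sq_le fun ω s hs => ?_
    have h1 := hval k s hs ω
    have h2 := hval m s hs ω
    have h3 : L * (T / (m + 1)) ≤ L * (T / (k + 1)) := by gcongr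
    rw [abs_le] at *
    constructor <;> linarith [h1.1, h1.2, h2.1, h2.2]

end DeterministicIntegrand

/-! ### Explicit solution of the equation and its terminal value. -/

section Solution

variable {Ω : Type*} {mΩ : MeasurableSpace Ω} {P : Measure Ω} {T : ℝ}
  {𝓕 : Filtration ℝ mΩ} {W B : ℝ → Ω → ℝ}

lemma measurable_intervalIntegral_of_continuous {m : MeasurableSpace Ω} {u : ℝ → Ω → ℝ}
    (hc : ∀ ω, Continuous fun s => u s ω) (hm : ∀ s, Measurable (u s)) (a b : ℝ) :
    Measurable fun ω => ∫ s in a..b, u s ω := by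
  have hu : StronglyMeasurable (fun p : Ω × ℝ => u p.2 p.1) :=
    ((measurable_uncurry_of_continuous_of_measurable hc hm).comp measurable_swap).stronglyMeasurable
  simp only [intervalIntegral]
  exact (hu.integral_prod_right.measurable).sub (hu.integral_prod_right.measurable)

/-- Clamping time to [0, t] does not change the integral and makes the integrand measurable at time
`t` for all real times. -/
lemma measurable_intervalIntegral_of_adapted {u : ℝ → Ω → ℝ} {t : ℝ} (ht : 0 ≤ t)
    (hc : ∀ ω, Continuous fun s => u s ω) (hm : ∀ s ∈ Icc 0 t, Measurable[𝓕 t] (u s)) :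
    Measurable[𝓕 t] fun ω => ∫ s in (0 : ℝ)..t, u s ω := by
  have h1 : Measurable[𝓕 t] fun ω => ∫ s in (0 : ℝ)..t, u (projIcc 0 t ht s) ω :=
    measurable_intervalIntegral_of_continuous (m := 𝓕 t)
      (fun ω => (hc ω).comp (continuous_subtype_val.comp continuous_projIcc))
      (fun s => hm _ (projIcc 0 t ht s).2) 0 t
  convert h1 using 2 with ω
  refine intervalIntegral.integral_congr fun s hs => ?_
  rw [uIcc_of_le ht] at hs
  simp only [projIcc_of_mem ht hs]

/-- The pathwise expression, by parts, of the Itô integral of `φ` along `B`. -/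
noncomputable def itoByParts (φ : ℝ → ℝ) (B : ℝ → Ω → ℝ) (t : ℝ) (ω : Ω) : ℝ :=
  φ t * B t ω - ∫ s in (0 : ℝ)..t, deriv φ s * B s ω

lemma eqOn_zero_of_support_subset_Iic {φ : ℝ → ℝ} (hφ : Continuous φ) {c : ℝ}
    (h : ∀ x, c < x → φ x = 0) : ∀ x, c ≤ x → φ x = 0 := by
  have : EqOn φ 0 (closure (Ioi c)) := by
    refine EqOn.closure (fun x hx => h x hx) hφ continuous_const
  rw [closure_Ioi] at this
  exact fun x hx => this hx

lemma deriv_eq_zero_of_eqOn_Ioi {φ : ℝ → ℝ} {c x : ℝ} (h : ∀ x, c < x → φ x = 0) (hx : c < x) :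
    deriv φ x = 0 := by
  have : φ =ᶠ[𝓝 x] fun _ => 0 := by
    filter_upwards [Ioi_mem_nhds hx] with y hy using h y hy
  rw [this.deriv_eq]; simp

/-- Beyond `c` the boundary term is zero and the integrand vanishes, so the process is frozen. -/
lemma itoByParts_of_le {φ : ℝ → ℝ} (hφ : ContDiff ℝ 1 φ) {c t : ℝ} (h : ∀ x, c < x → φ x = 0)
    (hct : c ≤ t) {ω : Ω} (hB : Continuous fun s => B s ω) :
    itoByParts φ B t ω = - ∫ s in (0 : ℝ)..c, deriv φ s * B s ω := by
  have hii : ∀ a b, IntervalIntegrable (fun s => deriv φ s * B s ω) volume a b := fun a b =>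
    ((hφ.continuous_deriv le_rfl).mul hB).intervalIntegrable a b
  have h0 : ∫ s in c..t, deriv φ s * B s ω = 0 := by
    refine intervalIntegral.integral_zero_ae (Eventually.of_forall fun s hs => ?_)
    rw [uIoc_of_le hct] at hs
    rw [deriv_eq_zero_of_eqOn_Ioi h hs.1, zero_mul]
  rw [itoByParts, eqOn_zero_of_support_subset_Iic hφ.continuous h t hct,
    ← intervalIntegral.integral_add_adjacent_intervals (hii 0 c) (hii c t), h0]
  ring

lemma continuous_itoByParts {φ : ℝ → ℝ} (hφ : ContDiff ℝ 1 φ) {ω : Ω}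
    (hB : Continuous fun s => B s ω) : Continuous fun t => itoByParts φ B t ω := by
  unfold itoByParts
  refine (hφ.continuous.mul hB).sub (intervalIntegral.continuous_primitive (fun a b => ?_) 0)
  exact ((hφ.continuous_deriv le_rfl).mul hB).intervalIntegrable a b

lemma measurable_itoByParts (hB : IsContinuousBrownianMotion P T 𝓕 B) {φ : ℝ → ℝ}
    (hφ : ContDiff ℝ 1 φ) {t : ℝ} (ht : t ∈ Icc 0 T) : Measurable[𝓕 t] (itoByParts φ B t) := by
  refine Measurable.sub ((hB.adapted t ht).const_mul _) ?_
  refine measurable_intervalIntegral_of_adapted ht.1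
    (fun ω => (hφ.continuous_deriv le_rfl).mul (hB.continuous ω)) fun s hs => ?_
  exact ((hB.adapted s ⟨hs.1, hs.2.trans ht.2⟩).mono (𝓕.mono hs.2) le_rfl).const_mul _

/-- The solution of the equation, given pathwise. -/
noncomputable def pathwiseSolution (f g h ψ : ℝ → ℝ) (B : ℝ → Ω → ℝ) (t : ℝ) (ω : Ω) :
    EuclideanSpace ℝ (Fin 4) :=
  !₂[t, itoByParts f B t ω, itoByParts g B t ω,
    ∫ s in (0 : ℝ)..t, h s * Real.cos (itoByParts f B s ω * ψ (itoByParts g B s ω))]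

section

variable {f g h ψ : ℝ → ℝ}

lemma continuous_drift_integrand (hf : ContDiff ℝ 1 f) (hg : ContDiff ℝ 1 g) (hh : Continuous h)
    (hψ : Continuous ψ) {ω : Ω} (hB : Continuous fun s => B s ω) :
    Continuous fun s => h s * Real.cos (itoByParts f B s ω * ψ (itoByParts g B s ω)) :=
  hh.mul (Real.continuous_cos.comp ((continuous_itoByParts hf hB).mul
    (hψ.comp (continuous_itoByParts hg hB))))

/-- The system is triangular: time drives the second and third components through deterministic
integrands, and the fourth is an ordinary integral of the others. Hence only the by-parts formula
and measurability are needed. -/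
lemma isStrongSolution_pathwiseSolution [IsProbabilityMeasure P]
    (hB : IsContinuousBrownianMotion P T 𝓕 B) (hT : 0 < T)
    (hBW : ∀ᵐ ω ∂P, ∀ t ∈ Icc 0 T, B t ω = W t ω)
    (hf : ContDiff ℝ 1 f) (hg : ContDiff ℝ 1 g) (hh : Continuous h) (hψ : Continuous ψ) :
    IsStrongSolution P T 𝓕 W (driftCoeff h ψ) (diffusionCoeff f g) 0
      (pathwiseSolution f g h ψ B) where
  adapted t ht := by
    refine (PiLp.continuous_toLp 2 _).measurable.comp (@measurable_pi_lambda _ _ _ (𝓕 t) _ _ ?_)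
    intro i
    fin_cases i
    · exact @measurable_const _ _ _ (𝓕 t) _
    · exact measurable_itoByParts hB hf ht
    · exact measurable_itoByParts hB hg ht
    · refine measurable_intervalIntegral_of_adapted ht.1
        (fun ω => continuous_drift_integrand hf hg hh hψ (hB.continuous ω)) fun s hs => ?_
      have hs' : s ∈ Icc 0 T := ⟨hs.1, hs.2.trans ht.2⟩
      refine Measurable.const_mul (Real.measurable_cos.comp (Measurable.mul ?_ ?_)) _
      · exact (measurable_itoByParts hB hf hs').mono (𝓕.mono hs.2) le_rfl
      · exact hψ.measurable.comp ((measurable_itoByParts hB hg hs').mono (𝓕.mono hs.2) le_rfl)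
  continuous_paths := by
    refine Eventually.of_forall fun ω => Continuous.continuousOn ?_
    refine (PiLp.continuous_toLp 2 _).comp (continuous_pi fun i => ?_)
    fin_cases i
    · exact continuous_id
    · exact continuous_itoByParts hf (hB.continuous ω)
    · exact continuous_itoByParts hg (hB.continuous ω)
    · exact intervalIntegral.continuous_primitive (fun a b =>
        (continuous_drift_integrand hf hg hh hψ (hB.continuous ω)).intervalIntegrable a b) 0
  start := by
    refine Eventually.of_forall fun ω => ?_
    ext i
    fin_cases i <;> simp [pathwiseSolution, itoByParts, hB.zero]
  drift_integrable := by
    refine Eventually.of_forall fun ω i => ?_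
    fin_cases i
    · simp [driftCoeff]
    · simp [driftCoeff]
    · simp [driftCoeff]
    · simpa [driftCoeff, pathwiseSolution] using
        (continuous_drift_integrand hf hg hh hψ (hB.continuous ω)).intervalIntegrable 0 T
  equation i := by
    have hWB : ∀ᵐ ω ∂P, ∀ t ∈ Icc 0 T, W t ω = B t ω := by
      filter_upwards [hBW] with ω hω t ht using (hω t ht).symm
    have h0 := isItoIntegral_of_contDiff hB hT (φ := fun _ => 0) contDiff_const
    fin_cases i
    · refine h0.congr hWB ?_ ?_
      · simp [diffusionCoeff]
      · simp [driftCoeff, pathwiseSolution]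
    · refine (isItoIntegral_of_contDiff hB hT hf).congr hWB ?_ ?_
      · simp [diffusionCoeff, pathwiseSolution]
      · simp [driftCoeff, pathwiseSolution, itoByParts]
    · refine (isItoIntegral_of_contDiff hB hT hg).congr hWB ?_ ?_
      · simp [diffusionCoeff, pathwiseSolution]
      · simp [driftCoeff, pathwiseSolution, itoByParts]
    · refine h0.congr hWB ?_ ?_
      · simp [diffusionCoeff]
      · simp [driftCoeff, pathwiseSolution]

lemma ae_forall_eq_of_continuousOn (hT : 0 < T) {U V : ℝ → Ω → ℝ}
    (hU : ∀ᵐ ω ∂P, ContinuousOn (fun t => U t ω) (Icc 0 T))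
    (hV : ∀ᵐ ω ∂P, ContinuousOn (fun t => V t ω) (Icc 0 T))
    (h : ∀ t ∈ Icc 0 T, ∀ᵐ ω ∂P, U t ω = V t ω) :
    ∀ᵐ ω ∂P, ∀ t ∈ Icc 0 T, U t ω = V t ω := by
  have hq : ∀ᵐ ω ∂P, ∀ q : ℚ, (q : ℝ) ∈ Icc 0 T → U q ω = V q ω := by
    rw [ae_all_iff]
    intro q
    by_cases hq : (q : ℝ) ∈ Icc 0 T
    · filter_upwards [h q hq] with ω hω _ using hω
    · exact Eventually.of_forall fun ω hc => absurd hc hq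
  filter_upwards [hU, hV, hq] with ω h1 h2 h3
  have h4 : EqOn (fun t => U t ω) (fun t => V t ω) (Ioo 0 T ∩ range ((↑) : ℚ → ℝ)) := by
    rintro _ ⟨hx, q, rfl⟩
    exact h3 q ⟨hx.1.le, hx.2.le⟩
  refine h4.of_subset_closure h1 h2 (fun x hx => ⟨hx.1.1.le, hx.1.2.le⟩) ?_
  have h5 : Ioo 0 T ⊆ closure (Ioo 0 T ∩ range ((↑) : ℚ → ℝ)) :=
    Rat.denseRange_cast.open_subset_closure_inter isOpen_Ioo
  rw [← closure_Ioo hT.ne]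
  exact closure_minimal h5 isClosed_closure

/-- The last component of a strong solution at the terminal time. -/
lemma IsStrongSolution.ae_eq_terminal [IsProbabilityMeasure P]
    (hB : IsContinuousBrownianMotion P T 𝓕 B) (hT : 0 < T)
    (hBW : ∀ᵐ ω ∂P, ∀ t ∈ Icc 0 T, B t ω = W t ω)
    (hf : ContDiff ℝ 1 f) (hg : ContDiff ℝ 1 g) (hh : Continuous h) (hψ : Continuous ψ)
    {τ₁ τ₂ : ℝ} (hτ₁₂ : τ₁ ≤ τ₂) (hτ₂0 : 0 ≤ τ₂) (hτ₂ : τ₂ ≤ T) (hf0 : ∀ x, τ₁ < x → f x = 0)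
    (hg0 : ∀ x, τ₂ < x → g x = 0) (hh0 : ∀ x, x < τ₂ → h x = 0)
    {X : ℝ → Ω → EuclideanSpace ℝ (Fin 4)}
    (hX : IsStrongSolution P T 𝓕 W (driftCoeff h ψ) (diffusionCoeff f g) 0 X) :
    ∀ᵐ ω ∂P, X T ω 3 = (∫ s in τ₂..T, h s) *
      Real.cos ((- ∫ s in (0 : ℝ)..τ₁, deriv f s * B s ω) *
        ψ (- ∫ s in (0 : ℝ)..τ₂, deriv g s * B s ω)) := by
  have hXm : ∀ t ∈ Icc 0 T, ∀ i, Measurable fun ω => X t ω i := fun t ht i =>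
    (PiLp.continuous_apply 2 _ i).measurable.comp ((hX.adapted t ht).mono (𝓕.le t) le_rfl)
  have hXc : ∀ i, ∀ᵐ ω ∂P, ContinuousOn (fun t => X t ω i) (Icc 0 T) := fun i => by
    filter_upwards [hX.continuous_paths] with ω hω
    exact (PiLp.continuous_apply 2 _ i).comp_continuousOn hω
  have hIto : ∀ φ : ℝ → ℝ, ContDiff ℝ 1 φ →
      IsItoIntegral P T 𝓕 W (fun s _ => φ s) (itoByParts φ B) := fun φ hφ =>
    (isItoIntegral_of_contDiff hB hT hφ).congr
      (by filter_upwards [hBW] with ω hω t ht using (hω t ht).symm) (by simp)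
      (by simp [itoByParts])
  have hItoB : ∀ {H I : ℝ → Ω → ℝ}, IsItoIntegral P T 𝓕 W H I → IsItoIntegral P T 𝓕 B H I :=
    fun hI => hI.congr hBW (by simp) (by simp)
  have hX0 : ∀ᵐ ω ∂P, ∀ t ∈ Icc 0 T, X t ω 0 = t := by
    refine ae_forall_eq_of_continuousOn (V := fun t _ => t) hT (hXc 0)
      (Eventually.of_forall fun ω => continuousOn_id) fun t ht => ?_
    have h1 := IsItoIntegral.ae_eq hB.toIsStandardBrownianMotion (φ := fun _ => 0)
      measurable_const (by simp [diffusionCoeff]) (by simp) (hItoB (hX.equation 0))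
      (hItoB (hIto (fun _ => 0) contDiff_const)) ht
      (by simpa [driftCoeff] using ((hXm t ht 0).sub_const t).aemeasurable)
      ((measurable_itoByParts hB contDiff_const ht).mono (𝓕.le t) le_rfl).aemeasurable
    filter_upwards [h1] with ω hω
    have : X t ω 0 - t = 0 := by simpa [driftCoeff, itoByParts] using hω
    linarith
  -- Once the first component is known to be time, the diffusion coefficients along X are
  -- deterministic, and uniqueness of the Itô integral identifies these components.
  have hX12 : ∀ (φ : ℝ → ℝ) (i : Fin 4), ContDiff ℝ 1 φ →
      (∀ x, diffusionCoeff f g x i = φ (x 0)) → (∀ x, driftCoeff h ψ x i = 0) →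
      ∀ᵐ ω ∂P, ∀ t ∈ Icc 0 T, X t ω i = itoByParts φ B t ω := by
    intro φ i hφ hσ hμ
    refine ae_forall_eq_of_continuousOn hT (hXc i) (Eventually.of_forall fun ω =>
      (continuous_itoByParts hφ (hB.continuous ω)).continuousOn) fun t ht => ?_
    have h1 := IsItoIntegral.ae_eq hB.toIsStandardBrownianMotion (φ := φ)
      hφ.continuous.measurable
      (by filter_upwards [hX0] with ω hω s hs; rw [hσ, hω s hs]) (by simp)
      (hItoB (hX.equation i)) (hItoB (hIto φ hφ)) ht
      (by simpa [hμ] using (hXm t ht i).aemeasurable)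
      ((measurable_itoByParts hB hφ ht).mono (𝓕.le t) le_rfl).aemeasurable
    filter_upwards [h1] with ω hω
    simpa [hμ] using hω
  have hX1 := hX12 f 1 hf (fun x => by simp [diffusionCoeff]) (fun x => by simp [driftCoeff])
  have hX2 := hX12 g 2 hg (fun x => by simp [diffusionCoeff]) (fun x => by simp [driftCoeff])
  have hdrift : ∀ᵐ ω ∂P, ∫ s in (0 : ℝ)..T, driftCoeff h ψ (X s ω) 3 = (∫ s in τ₂..T, h s) *
      Real.cos ((- ∫ s in (0 : ℝ)..τ₁, deriv f s * B s ω) *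
        ψ (- ∫ s in (0 : ℝ)..τ₂, deriv g s * B s ω)) := by
    filter_upwards [hX0, hX1, hX2] with ω h0 h1 h2
    have hcont := continuous_drift_integrand hf hg hh hψ (hB.continuous ω)
    have e1 : ∫ s in (0 : ℝ)..T, driftCoeff h ψ (X s ω) 3 = ∫ s in (0 : ℝ)..T,
        h s * Real.cos (itoByParts f B s ω * ψ (itoByParts g B s ω)) := by
      refine intervalIntegral.integral_congr fun s hs => ?_
      rw [uIcc_of_le hT.le] at hs
      simp [driftCoeff, h0 s hs, h1 s hs, h2 s hs]
    have e2 : ∫ s in (0 : ℝ)..τ₂,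
        h s * Real.cos (itoByParts f B s ω * ψ (itoByParts g B s ω)) = 0 := by
      refine intervalIntegral.integral_zero_ae ?_
      filter_upwards [Measure.ae_ne volume τ₂] with s hs hs'
      rw [uIoc_of_le hτ₂0] at hs'
      rw [hh0 s (lt_of_le_of_ne hs'.2 hs), zero_mul]
    -- Before τ₂ the factor h kills the integrand; after τ₂ both path integrals are frozen, so the
    -- cosine is constant in time and factors out.
    rw [e1, ← intervalIntegral.integral_add_adjacent_intervals (hcont.intervalIntegrable 0 τ₂)
      (hcont.intervalIntegrable τ₂ T), e2, zero_add, ← intervalIntegral.integral_mul_const]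
    refine intervalIntegral.integral_congr fun s hs => ?_
    rw [uIcc_of_le hτ₂] at hs
    rw [itoByParts_of_le hf hf0 (hτ₁₂.trans hs.1) (hB.continuous ω),
      itoByParts_of_le hg hg0 hs.1 (hB.continuous ω)]
  have hTm : T ∈ Icc 0 T := ⟨hT.le, le_rfl⟩
  -- For an arbitrary solution the measurability of the drift integral is inherited from the
  -- explicit formula it agrees with almost surely.
  have hmeasRHS : AEMeasurable (fun ω => X T ω 3 - (0 : EuclideanSpace ℝ (Fin 4)) 3 -
      ∫ s in (0 : ℝ)..T, driftCoeff h ψ (X s ω) 3) P := by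
    refine AEMeasurable.sub ((hXm T hTm 3).sub_const _).aemeasurable ?_
    refine AEMeasurable.congr (Measurable.aemeasurable ?_) (EventuallyEq.symm hdrift)
    have hYm : ∀ (φ : ℝ → ℝ) (c : ℝ), ContDiff ℝ 1 φ →
        Measurable fun ω => - ∫ s in (0 : ℝ)..c, deriv φ s * B s ω := fun φ c hφ =>
      (measurable_intervalIntegral_of_continuous
        (fun ω => (hφ.continuous_deriv le_rfl).mul (hB.continuous ω))
        (fun s => (hB.measurable s).const_mul _) 0 c).neg
    exact (Real.measurable_cos.comp
      ((hYm f τ₁ hf).mul (hψ.measurable.comp (hYm g τ₂ hg)))).const_mul _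
  have h3 := IsItoIntegral.ae_eq hB.toIsStandardBrownianMotion (φ := fun _ => 0)
      measurable_const (by simp [diffusionCoeff]) (by simp) (hItoB (hX.equation 3))
      (hItoB (hIto (fun _ => 0) contDiff_const)) hTm hmeasRHS
      ((measurable_itoByParts hB contDiff_const hTm).mono (𝓕.le T) le_rfl).aemeasurable
  filter_upwards [h3, hdrift] with ω hω hd
  have : X T ω 3 - ∫ s in (0 : ℝ)..T, driftCoeff h ψ (X s ω) 3 = 0 := by
    simpa [itoByParts] using hω
  rw [← hd]
  linarith

end

end Solution

/-! ### Dependence of adaptive methods on the path, and measurability. -/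

namespace AdaptiveMethod

variable {δ T : ℝ} (M : AdaptiveMethod δ T)

/-- The method halts after the evaluation number `n + 1`. -/
def HaltsAt (w : ℝ → ℝ) (n : ℕ) : Prop := M.halt n (M.data w (n + 1)) = true

/-- The method halts and evaluates the path only outside `A`. -/
def Avoids (A : Set ℝ) (w : ℝ → ℝ) : Prop :=
  M.Terminates w ∧ ∀ k ≤ M.haltIndex w, M.site k (M.data w k) ∉ A

variable {M} {w w' : ℝ → ℝ}

lemma Terminates.haltsAt (h : M.Terminates w) : M.HaltsAt w (M.haltIndex w) :=
  Nat.sInf_mem (s := {n | M.halt n (M.data w (n + 1)) = true}) h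

lemma not_haltsAt_of_lt {n : ℕ} (h : n < M.haltIndex w) : ¬ M.HaltsAt w n :=
  Nat.notMem_of_lt_sInf h

lemma haltIndex_eq {n : ℕ} (h : M.HaltsAt w n) (hlt : ∀ m < n, ¬ M.HaltsAt w m) :
    M.haltIndex w = n := by
  rcases lt_trichotomy (M.haltIndex w) n with h1 | h1 | h1
  · exact absurd (Terminates.haltsAt ⟨n, h⟩) (hlt _ h1)
  · exact h1
  · exact absurd h (not_haltsAt_of_lt h1)

/-- Each site is a function of the data gathered so far, so equal values at the sites chosen along
`w` force the same sites along `w'`. -/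
lemma data_congr (hv : EqOn w w' (Icc δ T)) {n : ℕ}
    (h : ∀ k < n, w (M.site k (M.data w k)) = w' (M.site k (M.data w k))) :
    M.data w n = M.data w' n := by
  have hv' : (fun t : Icc δ T => w t) = fun t : Icc δ T => w' t := funext fun t => hv t.2
  induction n with
  | zero => simp only [data, hv']; rfl
  | succ n ih =>
    have ih' := ih fun k hk => h k (hk.trans n.lt_succ_self)
    have h1 : M.observed w n = M.observed w' n := congrArg Prod.fst ih'
    have h2 : M.observed w (n + 1) = M.observed w' (n + 1) := by
      change Fin.snoc (α := fun _ => ℝ) (M.observed w n) (w (M.site n (M.data w n))) =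
        Fin.snoc (α := fun _ => ℝ) (M.observed w' n) (w' (M.site n (M.data w' n)))
      rw [h n n.lt_succ_self, ih', h1]
    simp only [data, h2, hv']

/-- A method cannot distinguish paths that differ only where it never looks. -/
lemma Avoids.congr {A : Set ℝ} (hw : M.Avoids A w) (h : EqOn w w' Aᶜ) (hv : EqOn w w' (Icc δ T)) :
    M.Avoids A w' ∧ M.haltIndex w' = M.haltIndex w ∧ M.result w' = M.result w := by
  have hd : ∀ n ≤ M.haltIndex w + 1, M.data w n = M.data w' n := fun n hn =>
    data_congr hv fun k hk => h (hw.2 k (by omega))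
  have hH : ∀ n ≤ M.haltIndex w, (M.HaltsAt w n ↔ M.HaltsAt w' n) := fun n hn => by
    unfold HaltsAt; rw [hd (n + 1) (by omega)]
  have hhalt : M.HaltsAt w' (M.haltIndex w) := (hH _ le_rfl).1 hw.1.haltsAt
  have hidx : M.haltIndex w' = M.haltIndex w :=
    haltIndex_eq hhalt fun m hm => (hH m hm.le).not.1 (not_haltsAt_of_lt hm)
  refine ⟨⟨⟨_, hhalt⟩, fun k hk => ?_⟩, hidx, ?_⟩
  · rw [hidx] at hk
    rw [← hd k (by omega)]
    exact hw.2 k hk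
  · unfold result
    rw [hidx, hd _ le_rfl]

lemma data_congr_of_eqOn (hδ : 0 ≤ δ) (hδT : δ ≤ T) (h : EqOn w w' (Icc 0 T)) (n : ℕ) :
    M.data w n = M.data w' n :=
  data_congr (fun _ ht => h ⟨hδ.trans ht.1, ht.2⟩) fun k _ =>
    h ⟨(M.site_mem k _).1.le, (M.site_mem k _).2.le.trans hδT⟩

lemma terminates_congr (hδ : 0 ≤ δ) (hδT : δ ≤ T) (h : EqOn w w' (Icc 0 T)) :
    M.Terminates w ↔ M.Terminates w' := by
  simp only [Terminates, data_congr_of_eqOn hδ hδT h]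

lemma haltIndex_congr (hδ : 0 ≤ δ) (hδT : δ ≤ T) (h : EqOn w w' (Icc 0 T)) :
    M.haltIndex w = M.haltIndex w' := by
  simp only [haltIndex, data_congr_of_eqOn hδ hδT h]

lemma numEval_congr (hδ : 0 ≤ δ) (hδT : δ ≤ T) (h : EqOn w w' (Icc 0 T)) :
    M.numEval w = M.numEval w' := by
  unfold numEval
  by_cases hw : M.Terminates w
  · rw [if_pos hw, if_pos ((terminates_congr hδ hδT h).1 hw), haltIndex_congr hδ hδT h]
  · rw [if_neg hw, if_neg ((terminates_congr hδ hδT h).not.1 hw)]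

lemma result_congr (hδ : 0 ≤ δ) (hδT : δ ≤ T) (h : EqOn w w' (Icc 0 T)) :
    M.result w = M.result w' := by
  unfold result
  rw [haltIndex_congr hδ hδT h, data_congr_of_eqOn hδ hδT h]

open Classical in
/-- Among disjoint sets, at most as many as there are evaluations are visited. -/
lemma card_not_avoids_le {ι : Type*} [Fintype ι] {A : ι → Set ℝ}
    (hA : ∀ i j, i ≠ j → Disjoint (A i) (A j)) (hw : M.Terminates w) :
    (Finset.univ.filter fun i => ¬ M.Avoids (A i) w).card ≤ M.haltIndex w + 1 := by
  have h1 : ∀ i, ¬ M.Avoids (A i) w →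
      ∃ k, k < M.haltIndex w + 1 ∧ M.site k (M.data w k) ∈ A i := by
    intro i hi
    by_contra! hc
    exact hi ⟨hw, fun k hk => hc k (by omega)⟩
  -- Assign to each visited set the number of an evaluation inside it; disjointness makes this
  -- injective.
  choose! κ hκ using h1
  rw [← Finset.card_range (M.haltIndex w + 1)]
  refine Finset.card_le_card_of_injOn κ (fun i hi => ?_) fun i hi j hj hij => ?_
  · simp only [Finset.coe_filter, Finset.mem_univ, true_and, mem_ofPred_eq] at hi
    simpa using (hκ i hi).1
  · simp only [Finset.coe_filter, Finset.mem_univ, true_and, mem_ofPred_eq] at hi hj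
    by_contra hne
    refine disjoint_left.1 (hA i j hne) (hκ i hi).2 ?_
    rw [hij]
    exact (hκ j hj).2

section Measurability

variable {Ω : Type*} {m : MeasurableSpace Ω} {V : ℝ → Ω → ℝ}

/-- Evaluation at a random site requires joint measurability in time and ω, which continuity
supplies. The σ-algebra is arbitrary so that the lemma also applies to the one generated by a
flattened path. -/
lemma measurable_data (hc : ∀ ω, Continuous fun t => V t ω) (hm : ∀ t, Measurable (V t)) (n : ℕ) :
    Measurable fun ω => M.data (fun t => V t ω) n := by
  have hV := measurable_uncurry_of_continuous_of_measurable hc hm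
  induction n with
  | zero =>
    refine Measurable.prodMk ?_ (measurable_pi_lambda _ fun t => hm t)
    exact measurable_pi_lambda _ fun i => i.elim0
  | succ n ih =>
    refine Measurable.prodMk ?_ (measurable_pi_lambda _ fun t => hm t)
    refine measurable_pi_lambda _ fun i => ?_
    change Measurable fun ω => Fin.snoc (α := fun _ => ℝ) (M.observed (fun t => V t ω) n)
      (V (M.site n (M.data (fun t => V t ω) n)) ω) i
    refine Fin.lastCases ?_ (fun j => ?_) i
    · simp only [Fin.snoc_last]
      exact hV.comp (((M.site_measurable n).comp ih).prodMk measurable_id)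
    · simp only [Fin.snoc_castSucc]
      exact (measurable_pi_apply j).comp (measurable_fst.comp ih)

lemma measurableSet_haltsAt (hc : ∀ ω, Continuous fun t => V t ω) (hm : ∀ t, Measurable (V t))
    (n : ℕ) : MeasurableSet {ω | M.HaltsAt (fun t => V t ω) n} :=
  ((M.halt_measurable n).comp (measurable_data hc hm (n + 1))) (measurableSet_singleton true)

lemma measurableSet_terminates (hc : ∀ ω, Continuous fun t => V t ω)
    (hm : ∀ t, Measurable (V t)) : MeasurableSet {ω | M.Terminates fun t => V t ω} := by
  have : {ω | M.Terminates fun t => V t ω} = ⋃ n, {ω | M.HaltsAt (fun t => V t ω) n} := by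
    ext ω; simp [Terminates, HaltsAt]
  rw [this]
  exact MeasurableSet.iUnion fun n => measurableSet_haltsAt hc hm n

lemma measurable_haltIndex (hc : ∀ ω, Continuous fun t => V t ω) (hm : ∀ t, Measurable (V t)) :
    Measurable fun ω => M.haltIndex fun t => V t ω := by
  refine measurable_to_countable' fun n => ?_
  -- The second set accounts for paths without halting, where the infimum of the empty set is 0.
  have : (fun ω => M.haltIndex fun t => V t ω) ⁻¹' {n} =
      ({ω | M.HaltsAt (fun t => V t ω) n} ∩ ⋂ k, ⋂ (_ : k < n), {ω | M.HaltsAt (fun t => V t ω) k}ᶜ)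
        ∪ ({ω | M.Terminates fun t => V t ω}ᶜ ∩ {_ω | n = 0}) := by
    ext ω
    simp only [mem_preimage, mem_singleton_iff, mem_union, mem_inter_iff, mem_ofPred_eq, mem_iInter,
      mem_compl_iff]
    constructor
    · rintro rfl
      by_cases hT : M.Terminates fun t => V t ω
      · exact Or.inl ⟨hT.haltsAt, fun k hk => not_haltsAt_of_lt hk⟩
      · refine Or.inr ⟨hT, ?_⟩
        have he : {n | M.halt n (M.data (fun t => V t ω) (n + 1)) = true} = ∅ :=
          eq_empty_iff_forall_notMem.2 fun n hn => hT ⟨n, hn⟩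
        rw [haltIndex, he, Nat.sInf_empty]
    · rintro (⟨h1, h2⟩ | ⟨h1, rfl⟩)
      · exact haltIndex_eq h1 h2
      · have he : {n | M.halt n (M.data (fun t => V t ω) (n + 1)) = true} = ∅ :=
          eq_empty_iff_forall_notMem.2 fun n hn => h1 ⟨n, hn⟩
        rw [haltIndex, he, Nat.sInf_empty]
  rw [this]
  refine ((measurableSet_haltsAt hc hm n).inter ?_).union
    ((measurableSet_terminates hc hm).compl.inter (MeasurableSet.const _))
  exact MeasurableSet.iInter fun k => MeasurableSet.iInter fun _ =>
    (measurableSet_haltsAt hc hm k).compl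

lemma measurable_result (hc : ∀ ω, Continuous fun t => V t ω) (hm : ∀ t, Measurable (V t)) :
    Measurable fun ω => M.result fun t => V t ω := by
  have h : Measurable fun p : ℕ × Ω => M.output p.1 (M.data (fun t => V t p.2) (p.1 + 1)) :=
    measurable_from_prod_countable_right fun n =>
      (M.output_measurable n).comp (measurable_data hc hm (n + 1))
  exact h.comp ((measurable_haltIndex hc hm).prodMk measurable_id)

lemma measurable_numEval (hc : ∀ ω, Continuous fun t => V t ω) (hm : ∀ t, Measurable (V t)) :
    Measurable fun ω => M.numEval fun t => V t ω := by
  unfold numEval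
  refine Measurable.ite (measurableSet_terminates hc hm) ?_ measurable_const
  exact ((measurable_of_countable (fun n : ℕ => (n : ℝ≥0∞))).comp
    (measurable_haltIndex hc hm)).add_const 1

lemma measurableSet_avoids (hc : ∀ ω, Continuous fun t => V t ω) (hm : ∀ t, Measurable (V t))
    {A : Set ℝ} (hA : MeasurableSet A) : MeasurableSet {ω | M.Avoids A fun t => V t ω} := by
  have : {ω | M.Avoids A fun t => V t ω} = {ω | M.Terminates fun t => V t ω} ∩
      ⋂ k, ({ω | M.haltIndex (fun t => V t ω) < k} ∪
        {ω | M.site k (M.data (fun t => V t ω) k) ∉ A}) := by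
    ext ω
    simp only [Avoids, mem_ofPred_eq, mem_inter_iff, mem_iInter, mem_union, ← not_le,
      ← imp_iff_not_or]
  rw [this]
  refine (measurableSet_terminates hc hm).inter (MeasurableSet.iInter fun k => ?_)
  refine MeasurableSet.union (measurableSet_lt (measurable_haltIndex hc hm) measurable_const) ?_
  exact ((M.site_measurable k).comp (measurable_data hc hm k)) hA.compl

end Measurability

end AdaptiveMethod

/-! ### Inapproximability of the cosine of a Gaussian variable. -/

section CosineLemma

/-- The mean of `cos (b + a G)` for a standard Gaussian variable, up to scaling. -/
lemma integral_cos_gaussianReal (b c : ℝ) (v : ℝ≥0) :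
    ∫ x, Real.cos (b + c * x) ∂(gaussianReal 0 v) = Real.cos b * Real.exp (- (v * c ^ 2 / 2)) := by
  have h1 := charFun_gaussianReal (μ := 0) (v := v) c
  rw [charFun_apply_real] at h1
  have h2 : ∫ x, Complex.exp (b * Complex.I) * Complex.exp (c * x * Complex.I)
      ∂(gaussianReal 0 v) = Complex.exp (b * Complex.I) * Complex.exp (- (v * c ^ 2 / 2)) := by
    rw [integral_const_mul, h1]
    congr 2
    push_cast; ring
  have hint : Integrable (fun x : ℝ => Complex.exp (b * Complex.I) *
      Complex.exp (c * x * Complex.I)) (gaussianReal 0 v) := by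
    refine Integrable.of_bound (by fun_prop) 1 (Eventually.of_forall fun x => ?_)
    rw [← Complex.exp_add, ← add_mul]
    exact_mod_cast (Complex.norm_exp_ofReal_mul_I (b + c * x)).le
  have h3 := (integral_re hint).trans (congrArg Complex.re h2)
  have e1 : ∀ x : ℝ, RCLike.re (Complex.exp (b * Complex.I) * Complex.exp (c * x * Complex.I)) =
      Real.cos (b + c * x) := fun x => by
    rw [← Complex.exp_add, ← add_mul]
    exact_mod_cast Complex.exp_ofReal_mul_I_re (b + c * x)
  have e2 : (Complex.exp (b * Complex.I) * Complex.exp (- (v * c ^ 2 / 2))).re =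
      Real.cos b * Real.exp (- (v * c ^ 2 / 2)) := by
    have : Complex.exp (- (v * c ^ 2 / 2)) = ((Real.exp (- (v * c ^ 2 / 2)) : ℝ) : ℂ) := by
      push_cast; rfl
    rw [this, Complex.re_mul_ofReal, Complex.exp_ofReal_mul_I_re]
  simp_rw [e1] at h3
  rw [h3, e2]

/-- If the argument of the cosine has a Gaussian part of large variance, then no constant is a
good approximation. -/
lemma le_integral_abs_cos_sub (b c x : ℝ) {v : ℝ≥0} (hv : 4 ≤ v * c ^ 2) :
    1 / 32 ≤ ∫ y, |Real.cos (b + c * y) - x| ∂(gaussianReal 0 v) := by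
  have hbd : ∀ (u : ℝ → ℝ) (_ : Continuous u) (C : ℝ), (∀ y, |u y| ≤ C) →
      Integrable u (gaussianReal 0 v) := fun u hu C hC =>
    Integrable.of_bound hu.aestronglyMeasurable C (Eventually.of_forall hC)
  have hcos : Continuous fun y : ℝ => Real.cos (b + c * y) := by fun_prop
  have hexp2 : Real.exp (-2) ≤ 1 / 7 := by
    rw [Real.exp_neg, ← one_div]
    refine one_div_le_one_div_of_le (by norm_num) ?_
    have h1 := Real.exp_one_gt_d9
    have h2 : Real.exp 2 = Real.exp 1 * Real.exp 1 := by rw [← Real.exp_add]; norm_num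
    rw [h2]; nlinarith
  have hmean : |∫ y, Real.cos (b + c * y) ∂(gaussianReal 0 v)| ≤ 1 / 7 := by
    rw [integral_cos_gaussianReal, abs_mul, Real.abs_exp]
    have h1 : Real.exp (-(v * c ^ 2 / 2)) ≤ Real.exp (-2) := Real.exp_le_exp.2 (by linarith)
    nlinarith [Real.abs_cos_le_one b, abs_nonneg (Real.cos b), Real.exp_pos (-(v * c ^ 2 / 2))]
  -- The double-angle formula reduces the second moment to a mean at doubled frequency, for which
  -- the same bound 1/7 suffices.
  have hsq : |∫ y, Real.cos (b + c * y) ^ 2 ∂(gaussianReal 0 v) - 1 / 2| ≤ 1 / 14 := by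
    have e : ∀ y, Real.cos (b + c * y) ^ 2 = 1 / 2 + Real.cos (2 * b + (2 * c) * y) / 2 := fun y => by
      rw [Real.cos_sq]; congr 3; ring
    have hi : Integrable (fun y => Real.cos (2 * b + (2 * c) * y) / 2) (gaussianReal 0 v) :=
      (hbd _ (by fun_prop) 1 fun y => Real.abs_cos_le_one _).div_const 2
    simp_rw [e]
    rw [integral_add (integrable_const _) hi, integral_div _ (fun a => Real.cos _),
      integral_cos_gaussianReal]
    simp only [integral_const, probReal_univ, smul_eq_mul, one_mul, add_sub_cancel_left]
    rw [abs_div, abs_mul, Real.abs_exp]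
    have h1 : Real.exp (-(v * (2 * c) ^ 2 / 2)) ≤ Real.exp (-2) :=
      Real.exp_le_exp.2 (by nlinarith)
    rw [abs_two]
    nlinarith [Real.abs_cos_le_one (2 * b), abs_nonneg (Real.cos (2 * b)),
      Real.exp_pos (-(v * (2 * c) ^ 2 / 2))]
  rw [abs_le] at hmean hsq
  have hi1 : Integrable (fun y => Real.cos (b + c * y)) (gaussianReal 0 v) :=
    hbd _ hcos 1 fun y => Real.abs_cos_le_one _
  have hi2 : Integrable (fun y => Real.cos (b + c * y) ^ 2) (gaussianReal 0 v) :=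
    hbd _ (hcos.pow 2) 1 fun y => by
      rw [abs_pow]; exact pow_le_one₀ (abs_nonneg _) (Real.abs_cos_le_one _)
  have hi3 : Integrable (fun y => |Real.cos (b + c * y) - x|) (gaussianReal 0 v) :=
    (hi1.sub (integrable_const x)).abs
  -- For |x| ≤ 1 use |cos - x| ≥ (cos - x)²/2 ≥ cos²/2 - x cos, of mean at least 3/14 - 1/7. For |x|
  -- > 1 use |cos - x| ≥ 1 - |cos| ≥ (1 - cos²)/2, of mean at least 3/14.
  rcases le_or_gt |x| 1 with hx | hx
  · have h1 : ∫ y, (Real.cos (b + c * y) ^ 2 / 2 - x * Real.cos (b + c * y)) ∂(gaussianReal 0 v) ≤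
        ∫ y, |Real.cos (b + c * y) - x| ∂(gaussianReal 0 v) := by
      refine integral_mono ((hi2.div_const 2).sub (hi1.const_mul x)) hi3 fun y => ?_
      have h2 := abs_le.1 hx
      have h3 := abs_le.1 (Real.abs_cos_le_one (b + c * y))
      have h4 : (Real.cos (b + c * y) - x) ^ 2 ≤ 2 * |Real.cos (b + c * y) - x| := by
        rw [← sq_abs, pow_two]
        refine mul_le_mul_of_nonneg_right ?_ (abs_nonneg _)
        rw [abs_le]; constructor <;> linarith [h2.1, h2.2, h3.1, h3.2]
      simp only
      nlinarith [sq_nonneg x]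
    rw [integral_sub (hi2.div_const 2) (hi1.const_mul x), integral_div, integral_const_mul] at h1
    have h2 : x * ∫ y, Real.cos (b + c * y) ∂(gaussianReal 0 v) ≤ 1 / 7 := by
      have h3 : |x * ∫ y, Real.cos (b + c * y) ∂(gaussianReal 0 v)| ≤ 1 * (1 / 7) := by
        rw [abs_mul]
        exact mul_le_mul hx (abs_le.2 hmean) (abs_nonneg _) zero_le_one
      linarith [le_abs_self (x * ∫ y, Real.cos (b + c * y) ∂(gaussianReal 0 v))]
    linarith [hsq.1]
  · have h1 : ∫ y, (1 - Real.cos (b + c * y) ^ 2) / 2 ∂(gaussianReal 0 v) ≤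
        ∫ y, |Real.cos (b + c * y) - x| ∂(gaussianReal 0 v) := by
      refine integral_mono (((integrable_const 1).sub hi2).div_const 2) hi3 fun y => ?_
      have h3 := Real.abs_cos_le_one (b + c * y)
      have h4 : |x| - |Real.cos (b + c * y)| ≤ |Real.cos (b + c * y) - x| := by
        rw [abs_sub_comm]; exact abs_sub_abs_le_abs_sub _ _
      have h5 := sq_abs (Real.cos (b + c * y))
      have h6 := abs_nonneg (Real.cos (b + c * y))
      simp only
      nlinarith
    rw [integral_div, integral_sub (integrable_const 1) hi2] at h1
    simp only [integral_const, probReal_univ, smul_eq_mul, one_mul] at h1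
    linarith [hsq.2]

lemma le_lintegral_enorm_cos_sub (b c x : ℝ) {v : ℝ≥0} (hv : 4 ≤ v * c ^ 2) :
    ENNReal.ofReal (1 / 32) ≤ ∫⁻ y, ‖Real.cos (b + c * y) - x‖ₑ ∂(gaussianReal 0 v) := by
  have hi : Integrable (fun y => Real.cos (b + c * y) - x) (gaussianReal 0 v) :=
    (Integrable.of_bound (by fun_prop) 1
      (Eventually.of_forall fun y => Real.abs_cos_le_one _)).sub (integrable_const x)
  rw [← ofReal_integral_norm_eq_lintegral_enorm hi]
  exact ENNReal.ofReal_le_ofReal (le_integral_abs_cos_sub b c x hv)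

end CosineLemma

/-! ### Error of a method on unvisited intervals, and averaging. -/

section LowerBound

/-- Approximating the cosine of a random variable with a conditionally Gaussian part of large
variance by a quantity independent of this part. -/
lemma le_setLIntegral_enorm_cos_sub {Ω : Type*} {𝒢 : MeasurableSpace Ω} {mΩ : MeasurableSpace Ω}
    {P : Measure Ω} [IsProbabilityMeasure P] (h𝒢 : 𝒢 ≤ mΩ) {ξ : Ω → ℝ} (hξ : Measurable ξ) {v : ℝ≥0} (hlaw : P.map ξ = gaussianReal 0 v)
    (hind : Indep 𝒢 (MeasurableSpace.comap ξ inferInstance) P) {a p x : Ω → ℝ}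
    (ha : Measurable[𝒢] a) (hp : Measurable[𝒢] p) (hx : Measurable[𝒢] x) {E : Set Ω}
    (hE : MeasurableSet[𝒢] E) (hv : ∀ ω ∈ E, 4 ≤ v * p ω ^ 2) :
    ENNReal.ofReal (1 / 32) * P E ≤ ∫⁻ ω in E, ‖Real.cos (a ω + p ω * ξ ω) - x ω‖ₑ ∂P := by
  -- All known quantities, including the event, are packed into one vector independent of ξ. Fubini
  -- then freezes them and leaves a one-dimensional Gaussian integral.
  let D : Ω → ℝ × ℝ × ℝ × ℝ≥0∞ := fun ω => (a ω, p ω, x ω, E.indicator 1 ω)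
  have hD𝒢 : Measurable[𝒢] D :=
    ha.prodMk (hp.prodMk (hx.prodMk (Measurable.indicator (m := 𝒢) measurable_const hE)))
  have hD : Measurable D := hD𝒢.mono h𝒢 le_rfl
  have hDξ : IndepFun D ξ P := indep_of_indep_of_le_left hind hD𝒢.comap_le
  have hmap := (indepFun_iff_map_prod_eq_prod_map_map hD.aemeasurable hξ.aemeasurable).1 hDξ
  let F : (ℝ × ℝ × ℝ × ℝ≥0∞) × ℝ → ℝ≥0∞ := fun q =>
    q.1.2.2.2 * ‖Real.cos (q.1.1 + q.1.2.1 * q.2) - q.1.2.2.1‖ₑ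
  have hF : Measurable F := by fun_prop
  have hE' : MeasurableSet E := h𝒢 _ hE
  have e1 : ∫⁻ ω in E, ‖Real.cos (a ω + p ω * ξ ω) - x ω‖ₑ ∂P = ∫⁻ ω, F (D ω, ξ ω) ∂P := by
    rw [← lintegral_indicator hE']
    refine lintegral_congr fun ω => ?_
    by_cases hω : ω ∈ E <;> simp [F, D, hω]
  have e2 : ∫⁻ ω, F (D ω, ξ ω) ∂P = ∫⁻ ω, ∫⁻ y, F (D ω, y) ∂(gaussianReal 0 v) ∂P := by
    rw [← lintegral_map (f := F) (g := fun ω => (D ω, ξ ω)) hF (hD.prodMk hξ), hmap, hlaw,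
      lintegral_prod _ hF.aemeasurable,
      lintegral_map (f := fun d => ∫⁻ y, F (d, y) ∂(gaussianReal 0 v)) hF.lintegral_prod_right' hD]
  rw [e1, e2, ← lintegral_indicator_one hE', ← lintegral_const_mul' _ _ ENNReal.ofReal_ne_top]
  refine lintegral_mono fun ω => ?_
  by_cases hω : ω ∈ E
  · simpa [F, D, hω] using le_lintegral_enorm_cos_sub (a ω) (p ω) (x ω) (hv ω hω)
  · simp [hω]

variable {Ω : Type*} {mΩ : MeasurableSpace Ω} {P : Measure Ω} {T : ℝ} {𝓕 : Filtration ℝ mΩ}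
  {B : ℝ → Ω → ℝ}

/-- The weighted time integral of the path up to time `c`, with negative sign. -/
noncomputable def pathIntegral (u : ℝ → ℝ) (c : ℝ) (w : ℝ → ℝ) : ℝ :=
  - ∫ r in (0 : ℝ)..c, u r * w r

lemma pathIntegral_eq_flattened (hB : IsContinuousBrownianMotion P T 𝓕 B) {u : ℝ → ℝ}
    (hu : Continuous u) (c s t : ℝ) (ω : Ω) :
    pathIntegral u c (fun r => B r ω) = pathIntegral u c (fun r => flattened B s t r ω) +
      pathIntegral u c (tent s t) * bridgeHeight B s t ω := by
  have h1 : ∀ r, u r * B r ω = u r * flattened B s t r ω +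
      (u r * tent s t r) * bridgeHeight B s t ω := fun r => by unfold flattened; ring
  unfold pathIntegral
  simp_rw [h1]
  have hi1 : IntervalIntegrable (fun r => u r * flattened B s t r ω) volume 0 c :=
    (hu.mul (hB.continuous_flattened ω)).intervalIntegrable 0 c
  have hi2 : IntervalIntegrable (fun r => u r * tent s t r * bridgeHeight B s t ω) volume 0 c :=
    ((hu.mul (continuous_tent s t)).intervalIntegrable 0 c).mul_const (bridgeHeight B s t ω)
  rw [intervalIntegral.integral_add hi1 hi2,
    intervalIntegral.integral_mul_const]
  ring

lemma pathIntegral_tent_eq_zero {u : ℝ → ℝ} {c s t : ℝ} (hst : s < t)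
    (hu : ∀ r ∈ Ioo s t, u r = 0) : pathIntegral u c (tent s t) = 0 := by
  have : ∀ r, u r * tent s t r = 0 := fun r => by
    by_cases hr : r ∈ Ioo s t
    · rw [hu r hr, zero_mul]
    · rw [tent_eq_zero hst hr, mul_zero]
  simp [pathIntegral, this]

/-- A continuous function without zeros on the interval has constant sign there, and the tent is
positive exactly there. -/
lemma pathIntegral_tent_ne_zero {u : ℝ → ℝ} (hu : Continuous u) {c s t : ℝ} (hs : 0 ≤ s)
    (hst : s < t) (htc : t ≤ c) (hu0 : ∀ r ∈ Ioo s t, u r ≠ 0) :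
    pathIntegral u c (tent s t) ≠ 0 := by
  have hii : ∀ a b, IntervalIntegrable (fun r => u r * tent s t r) volume a b := fun a b =>
    (hu.mul (continuous_tent s t)).intervalIntegrable a b
  have e : ∫ r in (0 : ℝ)..c, u r * tent s t r = ∫ r in s..t, u r * tent s t r := by
    have h1 : ∫ r in (0 : ℝ)..s, u r * tent s t r = 0 := by
      refine intervalIntegral.integral_zero_ae (Eventually.of_forall fun r hr => ?_)
      rw [uIoc_of_le hs] at hr
      rw [tent_eq_zero hst (fun h => absurd h.1 (not_lt.2 hr.2)), mul_zero]
    have h2 : ∫ r in t..c, u r * tent s t r = 0 := by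
      refine intervalIntegral.integral_zero_ae (Eventually.of_forall fun r hr => ?_)
      rw [uIoc_of_le htc] at hr
      rw [tent_eq_zero hst (fun h => absurd h.2 (not_lt.2 hr.1.le)), mul_zero]
    rw [← intervalIntegral.integral_add_adjacent_intervals (hii 0 s) (hii s c),
      ← intervalIntegral.integral_add_adjacent_intervals (hii s t) (hii t c), h1, h2]
    ring
  unfold pathIntegral
  rw [e, neg_ne_zero]
  by_cases hpos : ∀ r ∈ Ioo s t, 0 < u r
  · exact (intervalIntegral.intervalIntegral_pos_of_pos_on (hii s t)
      (fun r hr => mul_pos (hpos r hr) (tent_pos hr)) hst).ne'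
  · push Not at hpos
    obtain ⟨x, hx, hux⟩ := hpos
    have hneg : ∀ r ∈ Ioo s t, u r < 0 := by
      intro r hr
      by_contra hc
      obtain ⟨z, hz, huz⟩ := isPreconnected_Ioo.intermediate_value hx hr hu.continuousOn
        ⟨hux, not_lt.1 hc⟩
      exact hu0 z hz huz
    have := intervalIntegral.intervalIntegral_pos_of_pos_on (hii s t).neg
      (fun r hr => by
        have := mul_pos_of_neg_of_neg (hneg r hr) (neg_neg_of_pos (tent_pos hr))
        simpa using this) hst
    simp only [Pi.neg_apply] at this
    rw [intervalIntegral.integral_neg] at this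
    linarith

/-- The path flattened on `[s, t]`, stopped outside `[0, T]`. -/
noncomputable def stoppedFlattened (B : ℝ → Ω → ℝ) (T : ℝ) (hT : 0 ≤ T) (s t r : ℝ) (ω : Ω) : ℝ :=
  flattened B s t (projIcc 0 T hT r) ω

/-- The `σ`-algebra generated by the flattened path. -/
noncomputable abbrev flattenedSigma (B : ℝ → Ω → ℝ) (T s t : ℝ) : MeasurableSpace Ω :=
  MeasurableSpace.comap (fun ω (r : Icc 0 T) => flattened B s t r ω) inferInstance

/-- Independence of the bridge height is available only for times in [0, T]; clamping gives a
process on all of ℝ that is measurable for the σ-algebra of those times. -/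
lemma measurable_stoppedFlattened (hT : 0 ≤ T) (s t r : ℝ) :
    Measurable[flattenedSigma B T s t] (stoppedFlattened B T hT s t r) :=
  (measurable_pi_apply (projIcc 0 T hT r)).comp
    (comap_measurable fun ω (r : Icc 0 T) => flattened B s t r ω)

lemma continuous_stoppedFlattened (hB : IsContinuousBrownianMotion P T 𝓕 B) (hT : 0 ≤ T)
    (s t : ℝ) (ω : Ω) : Continuous fun r => stoppedFlattened B T hT s t r ω :=
  (hB.continuous_flattened ω).comp (continuous_subtype_val.comp continuous_projIcc)

lemma stoppedFlattened_eq (hT : 0 ≤ T) (s t : ℝ) {r : ℝ} (hr : r ∈ Icc 0 T) (ω : Ω) :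
    stoppedFlattened B T hT s t r ω = flattened B s t r ω := by
  unfold stoppedFlattened; rw [projIcc_of_mem hT hr]

lemma flattenedSigma_le (hB : IsContinuousBrownianMotion P T 𝓕 B) (s t : ℝ) :
    flattenedSigma B T s t ≤ mΩ :=
  (measurable_pi_lambda _ fun r : Icc 0 T => hB.measurable_flattened (r : ℝ)).comap_le

lemma indep_flattenedSigma [IsProbabilityMeasure P] (hB : IsContinuousBrownianMotion P T 𝓕 B)
    {s t : ℝ} (hs : 0 ≤ s) (hst : s < t) (ht : t ≤ T) :
    Indep (flattenedSigma B T s t)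
      (MeasurableSpace.comap (bridgeHeight B s t) inferInstance) P :=
  hB.indepFun_flattened_bridgeHeight hs hst ht

lemma measurable_pathIntegral_stoppedFlattened (hB : IsContinuousBrownianMotion P T 𝓕 B)
    (hT : 0 ≤ T) {u : ℝ → ℝ} (hu : Continuous u) (s t c : ℝ) :
    Measurable[flattenedSigma B T s t]
      fun ω => pathIntegral u c fun r => stoppedFlattened B T hT s t r ω :=
  (measurable_intervalIntegral_of_continuous (m := flattenedSigma B T s t)
    (fun ω => hu.mul (continuous_stoppedFlattened hB hT s t ω))
    (fun r => (measurable_stoppedFlattened hT s t r).const_mul _) 0 c).neg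

lemma pathIntegral_stoppedFlattened (hT : 0 ≤ T) (u : ℝ → ℝ) (s t : ℝ) {c : ℝ} (hc : c ∈ Icc 0 T)
    (ω : Ω) : pathIntegral u c (fun r => stoppedFlattened B T hT s t r ω) =
      pathIntegral u c (fun r => flattened B s t r ω) := by
  unfold pathIntegral
  congr 1
  refine intervalIntegral.integral_congr fun r hr => ?_
  rw [uIcc_of_le hc.1] at hr
  simp only [stoppedFlattened_eq hT s t ⟨hr.1, hr.2.trans hc.2⟩]

lemma measurable_pathIntegral (hB : IsContinuousBrownianMotion P T 𝓕 B) {u : ℝ → ℝ}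
    (hu : Continuous u) (c : ℝ) : Measurable fun ω => pathIntegral u c fun r => B r ω :=
  (measurable_intervalIntegral_of_continuous (fun ω => hu.mul (hB.continuous ω))
    (fun r => (hB.measurable r).const_mul _) 0 c).neg

/-- A nondegenerate path integral exceeds every level with positive probability. -/
lemma measure_pathIntegral_gt_pos [IsProbabilityMeasure P]
    (hB : IsContinuousBrownianMotion P T 𝓕 B) {u : ℝ → ℝ} (hu : Continuous u) {c s t : ℝ}
    (hc : c ∈ Icc 0 T) (hs : 0 ≤ s) (hst : s < t) (ht : t ≤ T)
    (hne : pathIntegral u c (tent s t) ≠ 0) (k : ℝ) :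
    0 < P {ω | k < pathIntegral u c fun r => B r ω} := by
  have hT : 0 ≤ T := by linarith
  set q := pathIntegral u c (tent s t) with hq
  let Z : Ω → ℝ := fun ω => pathIntegral u c fun r => stoppedFlattened B T hT s t r ω
  have hZ : Measurable[flattenedSigma B T s t] Z :=
    measurable_pathIntegral_stoppedFlattened hB hT hu s t c
  -- The law of the flattened part is not needed: it exceeds some -R with positive probability, and
  -- independently the Gaussian part exceeds k + R with positive probability.
  obtain ⟨R, hR⟩ : ∃ R : ℕ, 0 < P {ω | -(R : ℝ) < Z ω} := by
    by_contra! hcon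
    have huniv : (⋃ R : ℕ, {ω | -(R : ℝ) < Z ω}) = univ := by
      refine eq_univ_of_forall fun ω => mem_iUnion.2 ?_
      obtain ⟨R, hR⟩ := exists_nat_gt (- Z ω)
      exact ⟨R, show -(R : ℝ) < Z ω by linarith⟩
    have h0 : P univ = 0 := by
      rw [← huniv]
      exact measure_iUnion_null fun R => le_antisymm (hcon R) bot_le
    simp at h0
  have hopen : IsOpen {x : ℝ | k + R < q * x} := isOpen_lt (by fun_prop) (by fun_prop)
  have hpos : 0 < P ((bridgeHeight B s t) ⁻¹' {x : ℝ | k + R < q * x}) := by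
    rw [← Measure.map_apply hB.measurable_bridgeHeight hopen.measurableSet,
      hB.map_bridgeHeight hs hst ht, pos_iff_ne_zero]
    intro h0
    have hv : ((t - s) / 4).toNNReal ≠ 0 := by
      rw [Ne, Real.toNNReal_eq_zero]; linarith
    have h1 := gaussianReal_absolutelyContinuous' 0 hv h0
    refine (hopen.measure_pos volume ⟨(k + R + 1) / q, ?_⟩).ne' h1
    change k + R < q * ((k + R + 1) / q)
    rw [mul_div_cancel₀ _ hne]
    linarith
  have hind := (Indep_iff _ _ _).1 (indep_flattenedSigma hB hs hst ht) {ω | -(R : ℝ) < Z ω}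
    ((bridgeHeight B s t) ⁻¹' {x : ℝ | k + R < q * x}) (hZ measurableSet_Ioi)
    ⟨_, hopen.measurableSet, rfl⟩
  refine (ENNReal.mul_pos hR.ne' hpos.ne').trans_le ?_
  rw [← hind]
  refine measure_mono fun ω hω => ?_
  have h1 : -(R : ℝ) < Z ω := hω.1
  have h2 : k + R < q * bridgeHeight B s t ω := hω.2
  change k < pathIntegral u c fun r => B r ω
  rw [pathIntegral_eq_flattened hB hu c s t ω, ← pathIntegral_stoppedFlattened hT u s t hc ω]
  linarith

/-- Flattening alters the path only inside (s, t). Hence both the event of avoiding this interval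
and the output on it are determined by the flattened path, and so are independent of the bridge
height. -/
lemma AdaptiveMethod.avoids_flattened_iff {δ : ℝ} {M : AdaptiveMethod δ T} (hT : 0 ≤ T)
    (hδ : 0 ≤ δ) (hδT : δ ≤ T) {s t : ℝ} (hst : s < t) (htδ : t ≤ δ) (ω : Ω) :
    (M.Avoids (Ioo s t) (fun r => B r ω) ↔
      M.Avoids (Ioo s t) fun r => stoppedFlattened B T hT s t r ω) ∧
    (M.Avoids (Ioo s t) (fun r => B r ω) → M.result (fun r => B r ω) =
      M.result fun r => stoppedFlattened B T hT s t r ω) := by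
  have hoff : EqOn (fun r => B r ω) (fun r => flattened B s t r ω) (Ioo s t)ᶜ := fun r hr => by
    simp [flattened, tent_eq_zero hst hr]
  have hv : EqOn (fun r => B r ω) (fun r => flattened B s t r ω) (Icc δ T) := fun r hr =>
    hoff fun h => absurd h.2 (not_lt.2 (htδ.trans hr.1))
  have heq : EqOn (fun r => flattened B s t r ω) (fun r => stoppedFlattened B T hT s t r ω)
      (Icc 0 T) := fun r hr => (stoppedFlattened_eq hT s t hr ω).symm
  have hiff : M.Avoids (Ioo s t) (fun r => flattened B s t r ω) ↔
      M.Avoids (Ioo s t) fun r => stoppedFlattened B T hT s t r ω := by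
    simp only [Avoids, terminates_congr hδ hδT heq, haltIndex_congr hδ hδT heq,
      data_congr_of_eqOn hδ hδT heq]
  refine ⟨⟨fun h => hiff.1 (h.congr hoff hv).1, fun h => ((hiff.2 h).congr hoff.symm hv.symm).1⟩,
    fun h => ?_⟩
  rw [← (h.congr hoff hv).2.2, result_congr hδ hδT heq]

variable [IsProbabilityMeasure P] {δ : ℝ} {M : AdaptiveMethod δ T} {u₁ u₂ ψ : ℝ → ℝ} {c₁ c₂ : ℝ}

/-- The error of a method on the event that it does not visit `(s, t)`. -/
lemma le_setLIntegral_avoids (hB : IsContinuousBrownianMotion P T 𝓕 B) (hT : 0 ≤ T)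
    (hδ : 0 ≤ δ) (hδT : δ ≤ T) (hu₁ : Continuous u₁) (hu₂ : Continuous u₂) (hψ : Continuous ψ)
    (hc₁ : c₁ ∈ Icc 0 T) (hc₂ : c₂ ∈ Icc 0 T) {s t : ℝ} (hs : 0 ≤ s) (hst : s < t) (htδ : t ≤ δ)
    (h2 : pathIntegral u₂ c₂ (tent s t) = 0) {k : ℝ}
    (hk : ∀ z, k < z → 4 ≤ (t - s) / 4 * (pathIntegral u₁ c₁ (tent s t) * ψ z) ^ 2) (C : ℝ) :
    ENNReal.ofReal (1 / 32) * P {ω | M.Avoids (Ioo s t) (fun r => B r ω) ∧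
      k < pathIntegral u₂ c₂ fun r => B r ω} ≤
    ∫⁻ ω in {ω | M.Avoids (Ioo s t) (fun r => B r ω) ∧ k < pathIntegral u₂ c₂ fun r => B r ω},
      ‖Real.cos ((pathIntegral u₁ c₁ fun r => B r ω) * ψ (pathIntegral u₂ c₂ fun r => B r ω)) -
        M.result (fun r => B r ω) 3 / C‖ₑ ∂P := by
  set q := pathIntegral u₁ c₁ (tent s t) with hq
  let V : ℝ → Ω → ℝ := stoppedFlattened B T hT s t
  let Y : Ω → ℝ := fun ω => pathIntegral u₁ c₁ fun r => V r ω
  let Z : Ω → ℝ := fun ω => pathIntegral u₂ c₂ fun r => V r ω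
  have hY : Measurable[flattenedSigma B T s t] Y :=
    measurable_pathIntegral_stoppedFlattened hB hT hu₁ s t c₁
  have hZ : Measurable[flattenedSigma B T s t] Z :=
    measurable_pathIntegral_stoppedFlattened hB hT hu₂ s t c₂
  have hVc : ∀ ω, Continuous fun r => V r ω := continuous_stoppedFlattened hB hT s t
  have hVm : ∀ r, Measurable[flattenedSigma B T s t] (V r) := measurable_stoppedFlattened hT s t
  have hZB : ∀ ω, (pathIntegral u₂ c₂ fun r => B r ω) = Z ω := fun ω => by
    rw [pathIntegral_eq_flattened hB hu₂ c₂ s t ω, h2, zero_mul, add_zero,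
      ← pathIntegral_stoppedFlattened hT u₂ s t hc₂ ω]
  have hYB : ∀ ω, (pathIntegral u₁ c₁ fun r => B r ω) = Y ω + q * bridgeHeight B s t ω :=
    fun ω => by
      rw [pathIntegral_eq_flattened hB hu₁ c₁ s t ω,
        ← pathIntegral_stoppedFlattened hT u₁ s t hc₁ ω]
  have hav := fun ω => AdaptiveMethod.avoids_flattened_iff (B := B) (M := M) hT hδ hδT hst htδ ω
  have hset : {ω | M.Avoids (Ioo s t) (fun r => B r ω) ∧
      k < pathIntegral u₂ c₂ fun r => B r ω} =
      {ω | M.Avoids (Ioo s t) fun r => V r ω} ∩ {ω | k < Z ω} := by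
    ext ω
    simp only [mem_ofPred_eq, mem_inter_iff, hZB, (hav ω).1, V]
  have hE : MeasurableSet[flattenedSigma B T s t]
      ({ω | M.Avoids (Ioo s t) fun r => V r ω} ∩ {ω | k < Z ω}) :=
    MeasurableSet.inter (m := flattenedSigma B T s t)
      (AdaptiveMethod.measurableSet_avoids (m := flattenedSigma B T s t) hVc hVm measurableSet_Ioo)
      (hZ measurableSet_Ioi)
  have hx : Measurable[flattenedSigma B T s t] fun ω => M.result (fun r => V r ω) 3 / C :=
    Measurable.div_const ((PiLp.continuous_apply 2 _ 3).measurable.comp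
      (AdaptiveMethod.measurable_result (m := flattenedSigma B T s t) hVc hVm)) C
  have key := le_setLIntegral_enorm_cos_sub (flattenedSigma_le hB s t)
    hB.measurable_bridgeHeight (hB.map_bridgeHeight hs hst (htδ.trans hδT))
    (indep_flattenedSigma hB hs hst (htδ.trans hδT)) (a := fun ω => Y ω * ψ (Z ω))
    (p := fun ω => q * ψ (Z ω)) (hY.mul (hψ.measurable.comp hZ))
    ((hψ.measurable.comp hZ).const_mul q) hx hE (fun ω hω => by
      rw [Real.coe_toNNReal _ (by linarith)]
      exact hk _ hω.2)
  rw [hset]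
  refine key.trans_eq (setLIntegral_congr_fun (flattenedSigma_le hB s t _ hE) fun ω hω => ?_)
  have hres := (hav ω).2 ((hav ω).1.2 hω.1)
  simp only [hZB, hYB, hres]
  congr 3
  ring

/-- The error of a method, if it uses at most `n` evaluations with a substantial probability. -/
lemma le_lintegral_of_numEval_le (hB : IsContinuousBrownianMotion P T 𝓕 B) (hT : 0 ≤ T)
    (hδ : 0 ≤ δ) (hδT : δ ≤ T) (hu₁ : Continuous u₁) (hu₂ : Continuous u₂) (hψ : Continuous ψ)
    (hc₁ : c₁ ∈ Icc 0 T) (hc₂ : c₂ ∈ Icc 0 T) {n : ℕ} (hn : 0 < n) {s t : Fin (2 * n) → ℝ}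
    (hs : ∀ j, 0 ≤ s j) (hst : ∀ j, s j < t j) (htδ : ∀ j, t j ≤ δ)
    (hdisj : ∀ i j, i ≠ j → Disjoint (Ioo (s i) (t i)) (Ioo (s j) (t j)))
    (h2 : ∀ j, pathIntegral u₂ c₂ (tent (s j) (t j)) = 0) {k : ℝ}
    (hk : ∀ j z, k < z →
      4 ≤ (t j - s j) / 4 * (pathIntegral u₁ c₁ (tent (s j) (t j)) * ψ z) ^ 2) (C : ℝ) :
    ENNReal.ofReal (1 / 64) * P {ω | M.numEval (fun r => B r ω) ≤ n ∧
      k < pathIntegral u₂ c₂ fun r => B r ω} ≤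
    ∫⁻ ω, ‖Real.cos ((pathIntegral u₁ c₁ fun r => B r ω) * ψ (pathIntegral u₂ c₂ fun r => B r ω)) -
        M.result (fun r => B r ω) 3 / C‖ₑ ∂P := by
  classical
  set F : Ω → ℝ≥0∞ := fun ω => ‖Real.cos ((pathIntegral u₁ c₁ fun r => B r ω) *
    ψ (pathIntegral u₂ c₂ fun r => B r ω)) - M.result (fun r => B r ω) 3 / C‖ₑ with hF
  set A : Set Ω := {ω | M.numEval (fun r => B r ω) ≤ n ∧
      k < pathIntegral u₂ c₂ fun r => B r ω} with hA
  let E : Fin (2 * n) → Set Ω := fun j => {ω | M.Avoids (Ioo (s j) (t j)) (fun r => B r ω) ∧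
      k < pathIntegral u₂ c₂ fun r => B r ω}
  have hEm : ∀ j, MeasurableSet (E j) := fun j =>
    (AdaptiveMethod.measurableSet_avoids hB.continuous hB.measurable measurableSet_Ioo).inter
      (measurable_pathIntegral hB hu₂ c₂ measurableSet_Ioi)
  have hAm : MeasurableSet A :=
    ((AdaptiveMethod.measurable_numEval hB.continuous hB.measurable) measurableSet_Iic).inter
      (measurable_pathIntegral hB hu₂ c₂ measurableSet_Ioi)
  -- At most n of the 2n disjoint intervals are visited. Summing the errors over all intervals
  -- therefore costs only a factor 2.
  have hcount : ∀ ω ∈ A, (n : ℝ≥0∞) ≤ ∑ j, (E j).indicator 1 ω := by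
    rintro ω ⟨hω, hkω⟩
    have hterm : M.Terminates fun r => B r ω := by
      by_contra hc
      rw [AdaptiveMethod.numEval, if_neg hc] at hω
      exact absurd hω (not_le.2 (ENNReal.natCast_lt_top n))
    have hidx : M.haltIndex (fun r => B r ω) + 1 ≤ n := by
      rw [AdaptiveMethod.numEval, if_pos hterm] at hω
      exact_mod_cast hω
    have h1 := AdaptiveMethod.card_not_avoids_le hdisj hterm
    have h3 := Finset.card_filter_add_card_filter_not (s := (Finset.univ : Finset (Fin (2 * n))))
      (p := fun j => M.Avoids (Ioo (s j) (t j)) fun r => B r ω)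
    rw [Finset.card_univ, Fintype.card_fin] at h3
    have h4 : n ≤ (Finset.univ.filter fun j => M.Avoids (Ioo (s j) (t j)) fun r => B r ω).card := by
      omega
    have h5 : ∑ j, (E j).indicator (1 : Ω → ℝ≥0∞) ω =
        ((Finset.univ.filter fun j => M.Avoids (Ioo (s j) (t j)) fun r => B r ω).card : ℝ≥0∞) := by
      rw [Finset.card_filter]
      push_cast
      refine Finset.sum_congr rfl fun j _ => ?_
      simp [indicator_apply, E, hkω]
    rw [h5]
    exact_mod_cast h4
  have hsum : ENNReal.ofReal (1 / 32) * (n * P A) ≤ 2 * n * ∫⁻ ω, F ω ∂P := by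
    calc ENNReal.ofReal (1 / 32) * (n * P A)
        ≤ ENNReal.ofReal (1 / 32) * ∑ j, P (E j) := by
          gcongr
          have h1 : (n : ℝ≥0∞) * P A = ∫⁻ ω in A, n ∂P := by rw [setLIntegral_const]
          rw [h1]
          refine (setLIntegral_mono' hAm hcount).trans ((setLIntegral_le_lintegral _ _).trans_eq ?_)
          rw [lintegral_finsetSum _ fun j _ => measurable_one.indicator (hEm j)]
          simp_rw [lintegral_indicator_one (hEm _)]
      _ = ∑ j, ENNReal.ofReal (1 / 32) * P (E j) := Finset.mul_sum _ _ _
      _ ≤ ∑ j : Fin (2 * n), ∫⁻ ω, F ω ∂P := Finset.sum_le_sum fun j _ =>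
          (le_setLIntegral_avoids hB hT hδ hδT hu₁ hu₂ hψ hc₁ hc₂ (hs j) (hst j) (htδ j) (h2 j)
            (hk j) C).trans (setLIntegral_le_lintegral _ _)
      _ = 2 * n * ∫⁻ ω, F ω ∂P := by simp
  have hn0 : (2 * n : ℝ≥0∞) ≠ 0 := by
    have : (n : ℝ≥0∞) ≠ 0 := by exact_mod_cast hn.ne'
    exact mul_ne_zero two_ne_zero this
  have hntop : (2 * n : ℝ≥0∞) ≠ ∞ := ENNReal.mul_ne_top (by norm_num) (ENNReal.natCast_ne_top n)
  rw [← ENNReal.mul_le_mul_iff_right hn0 hntop]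
  refine le_trans (le_of_eq ?_) hsum
  have h32 : ENNReal.ofReal (1 / 32) = 2 * ENNReal.ofReal (1 / 64) := by
    rw [← ENNReal.ofReal_ofNat 2, ← ENNReal.ofReal_mul (by norm_num)]
    norm_num
  rw [h32]
  ring

/-- The error of a method with `N` evaluations on average. -/
lemma le_lintegral_of_lintegral_numEval_le (hB : IsContinuousBrownianMotion P T 𝓕 B) (hT : 0 ≤ T)
    (hδ : 0 ≤ δ) (hδT : δ ≤ T) (hu₁ : Continuous u₁) (hu₂ : Continuous u₂) (hψ : Continuous ψ)
    (hc₁ : c₁ ∈ Icc 0 T) (hc₂ : c₂ ∈ Icc 0 T) {n : ℕ} (hn : 0 < n) {s t : Fin (2 * n) → ℝ}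
    (hs : ∀ j, 0 ≤ s j) (hst : ∀ j, s j < t j) (htδ : ∀ j, t j ≤ δ)
    (hdisj : ∀ i j, i ≠ j → Disjoint (Ioo (s i) (t i)) (Ioo (s j) (t j)))
    (h2 : ∀ j, pathIntegral u₂ c₂ (tent (s j) (t j)) = 0) {k : ℝ}
    (hk : ∀ j z, k < z →
      4 ≤ (t j - s j) / 4 * (pathIntegral u₁ c₁ (tent (s j) (t j)) * ψ z) ^ 2) (C : ℝ) {N : ℕ}
    (hN : ∫⁻ ω, M.numEval (fun r => B r ω) ∂P ≤ N)
    (hnN : (N : ℝ≥0∞) ≤ n * (P {ω | k < pathIntegral u₂ c₂ fun r => B r ω} / 2)) :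
    ENNReal.ofReal (1 / 128) * P {ω | k < pathIntegral u₂ c₂ fun r => B r ω} ≤
    ∫⁻ ω, ‖Real.cos ((pathIntegral u₁ c₁ fun r => B r ω) * ψ (pathIntegral u₂ c₂ fun r => B r ω)) -
        M.result (fun r => B r ω) 3 / C‖ₑ ∂P := by
  refine le_trans ?_ (le_lintegral_of_numEval_le hB hT hδ hδT hu₁ hu₂ hψ hc₁ hc₂ hn hs hst htδ
    hdisj h2 hk C)
  set A : Set Ω := {ω | k < pathIntegral u₂ c₂ fun r => B r ω} with hA
  set A' : Set Ω := {ω | M.numEval (fun r => B r ω) ≤ n ∧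
    k < pathIntegral u₂ c₂ fun r => B r ω} with hA'
  -- By the choice of n, expensive runs can cover at most half of the event that the path integral
  -- exceeds k.
  have hmarkov : P {ω | (n : ℝ≥0∞) ≤ M.numEval fun r => B r ω} ≤ P A / 2 := by
    have h1 := mul_meas_ge_le_lintegral (μ := P)
      (AdaptiveMethod.measurable_numEval (M := M) hB.continuous hB.measurable) (n : ℝ≥0∞)
    have hn0 : (n : ℝ≥0∞) ≠ 0 := by exact_mod_cast hn.ne'
    rw [← ENNReal.mul_le_mul_iff_right hn0 (ENNReal.natCast_ne_top n)]
    exact h1.trans (hN.trans hnN)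
  have hsplit : P A ≤ P A' + P A / 2 := by
    refine (measure_mono (t := A' ∪ {ω | (n : ℝ≥0∞) ≤ M.numEval fun r => B r ω})
      fun ω hω => ?_).trans ((measure_union_le _ _).trans (add_le_add le_rfl hmarkov))
    rcases le_total (M.numEval fun r => B r ω) n with h | h
    · exact Or.inl ⟨h, hω⟩
    · exact Or.inr h
  have hhalf : P A / 2 ≤ P A' := by
    have hfin : P A / 2 ≠ ∞ := (ENNReal.div_lt_top (measure_ne_top P A) two_ne_zero).ne
    rw [← ENNReal.add_le_add_iff_right hfin, ENNReal.add_halves]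
    exact hsplit
  calc ENNReal.ofReal (1 / 128) * P A = ENNReal.ofReal (1 / 64) * (P A / 2) := by
        have : ENNReal.ofReal (1 / 64) = ENNReal.ofReal (1 / 128) * 2 := by
          rw [← ENNReal.ofReal_ofNat 2, ← ENNReal.ofReal_mul (by norm_num)]
          norm_num
        rw [this, mul_assoc, ENNReal.mul_div_cancel two_ne_zero (by norm_num)]
    _ ≤ ENNReal.ofReal (1 / 64) * P A' := by gcongr

end LowerBound

/-! ### Choice of levels and of the frequency ψ, and conclusion. -/

section MainTheorem

lemma deriv_eq_zero_of_eqOn_Iio {φ : ℝ → ℝ} {c x : ℝ} (h : ∀ x, x < c → φ x = 0) (hx : x < c) :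
    deriv φ x = 0 := by
  have : φ =ᶠ[𝓝 x] fun _ => 0 := by
    filter_upwards [Iio_mem_nhds hx] with y hy using h y hy
  rw [this.deriv_eq]; simp

/-- A smooth function which is large beyond each term of a sequence tending to infinity. -/
lemma exists_contDiff_forall_le (k K : ℕ → ℝ) (hk : Tendsto k atTop atTop) :
    ∃ ψ : ℝ → ℝ, ContDiff ℝ (⊤ : ℕ∞) ψ ∧ ∀ N z, k N < z → K N ≤ ψ z := by
  have hconv : ∀ z : ℝ, Convex ℝ {y : ℝ | ∀ N, k N < z → K N ≤ y} := fun z => by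
    have : {y : ℝ | ∀ N, k N < z → K N ≤ y} = ⋂ N, ⋂ (_ : k N < z), Ici (K N) := by
      ext y; simp
    rw [this]
    exact convex_iInter fun N => convex_iInter fun _ => convex_Ici _
  -- Only finitely many k N lie below x + 1, so a constant works near x; as the constraints are
  -- convex, a smooth partition of unity glues these constants.
  have hloc : ∀ x : ℝ, ∃ c : ℝ, ∀ᶠ z in 𝓝 x, c ∈ {y : ℝ | ∀ N, k N < z → K N ≤ y} := fun x => by
    obtain ⟨N₀, hN₀⟩ := eventually_atTop.1 (hk.eventually_ge_atTop (x + 1))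
    refine ⟨∑ N ∈ Finset.range N₀, |K N|, ?_⟩
    filter_upwards [Iio_mem_nhds (lt_add_one x)] with z hz N hN
    have hlt : N < N₀ := by
      by_contra hc
      exact absurd (hN₀ N (not_lt.1 hc)) (not_le.2 (hN.trans hz))
    exact (le_abs_self _).trans
      (Finset.single_le_sum (f := fun N => |K N|) (fun _ _ => abs_nonneg _) (Finset.mem_range.2 hlt))
  obtain ⟨ψ, hψ⟩ := exists_contMDiffMap_forall_mem_convex_of_local_const
    (modelWithCornersSelf ℝ ℝ) (n := (⊤ : ℕ∞)) hconv hloc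
  exact ⟨ψ, ψ.contMDiff.contDiff, fun N z hz => hψ z N hz⟩

/-- Levels tending to infinity whose tails dominate a given null sequence. -/
lemma exists_tendsto_atTop_forall_le (p a : ℕ → ℝ) (hp : ∀ j, 0 < p j)
    (ha : Tendsto a atTop (𝓝 0)) :
    ∃ κ : ℝ, 0 < κ ∧ ∃ k : ℕ → ℕ, Tendsto k atTop atTop ∧ ∀ N, κ * a N ≤ p (k N) := by
  obtain ⟨A, hA⟩ := ha.bddAbove_range
  have hA' : ∀ N, a N ≤ |A| + 1 := fun N =>
    (hA (mem_range_self N)).trans ((le_abs_self A).trans (by linarith))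
  have hpos : 0 < |A| + 1 := by positivity
  have hκ : 0 < p 0 / (|A| + 1) := div_pos (hp 0) hpos
  classical
  -- The level is the largest admissible j ≤ N. This choice of κ makes j = 0 always admissible, and
  -- a fixed j becomes admissible eventually because a tends to 0.
  refine ⟨p 0 / (|A| + 1), hκ,
    fun N => Nat.findGreatest (fun j => p 0 / (|A| + 1) * a N ≤ p j) N, ?_, fun N => ?_⟩
  · refine tendsto_atTop.2 fun j => ?_
    have h1 : Tendsto (fun N => p 0 / (|A| + 1) * a N) atTop (𝓝 0) := by
      simpa using ha.const_mul (p 0 / (|A| + 1))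
    filter_upwards [eventually_ge_atTop j, h1.eventually_le_const (hp j)] with N hN hle
    exact Nat.le_findGreatest hN hle
  · refine Nat.findGreatest_spec (P := fun j => p 0 / (|A| + 1) * a N ≤ p j) (Nat.zero_le N) ?_
    rw [div_mul_eq_mul_div, div_le_iff₀ hpos]
    exact mul_le_mul_of_nonneg_left (hA' N) (hp 0).le

/-- A nonzero `C¹` function supported in a compact interval has nonvanishing derivative on some
open subinterval. -/
lemma exists_Ioo_deriv_ne_zero {g : ℝ → ℝ} (hg : ContDiff ℝ 1 g) {a b : ℝ}
    (hsupp : Function.support g ⊆ Icc a b) (hne : g ≠ 0) :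
    ∃ s t, a ≤ s ∧ s < t ∧ t ≤ b ∧ ∀ r ∈ Ioo s t, deriv g r ≠ 0 := by
  have hopen : IsOpen {x | deriv g x ≠ 0} := isOpen_ne_fun (hg.continuous_deriv le_rfl) continuous_const
  have hz : ∀ x, x ∉ Icc a b → g x = 0 := fun x hx => by
    by_contra hc; exact hx (hsupp hc)
  have hsub : {x | deriv g x ≠ 0} ⊆ Icc a b := by
    intro x hx
    by_contra hc
    rw [mem_Icc, not_and_or, not_le, not_le] at hc
    rcases hc with hc | hc
    · exact hx (deriv_eq_zero_of_eqOn_Iio (fun y hy => hz y fun h => absurd h.1 (not_le.2 hy)) hc)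
    · exact hx (deriv_eq_zero_of_eqOn_Ioi (fun y hy => hz y fun h => absurd h.2 (not_le.2 hy)) hc)
  have hnonempty : ∃ x, deriv g x ≠ 0 := by
    by_contra! hc
    refine hne (funext fun x => ?_)
    rw [is_const_of_deriv_eq_zero (hg.differentiable one_ne_zero) hc x (b + 1)]
    exact hz _ fun h => by linarith [h.2]
  obtain ⟨x, hx⟩ := hnonempty
  obtain ⟨ε, hε, hball⟩ := Metric.isOpen_iff.1 hopen x hx
  rw [Real.ball_eq_Ioo] at hball
  -- The derivative vanishes off [a, b], so the open ball lies in [a, b]; taking closures puts its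
  -- endpoints there too.
  have hIcc : Icc (x - ε) (x + ε) ⊆ Icc a b := by
    rw [← closure_Ioo (by linarith)]
    exact closure_minimal (hball.trans hsub) isClosed_Icc
  refine ⟨x - ε, x + ε, (hIcc (left_mem_Icc.2 (by linarith))).1, by linarith,
    (hIcc (right_mem_Icc.2 (by linarith))).2, fun r hr => hball hr⟩

variable {Ω : Type*} {mΩ : MeasurableSpace Ω} {P : Measure Ω} {T : ℝ} {𝓕 : Filtration ℝ mΩ}
  {B : ℝ → Ω → ℝ}

/-- For every budget, every method fails if the frequency `ψ` is large enough on `(k, ∞)`. -/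
lemma exists_frequency_bound [IsProbabilityMeasure P] (hB : IsContinuousBrownianMotion P T 𝓕 B)
    {u₁ u₂ : ℝ → ℝ} (hu₁ : Continuous u₁) (hu₂ : Continuous u₂) {c₁ c₂ : ℝ}
    (hc₁ : c₁ ∈ Icc 0 T) (hc₂ : c₂ ∈ Icc 0 T) {d : ℝ} (hd : 0 < d) (hdc : d ≤ c₁)
    (hne : ∀ r ∈ Ioo 0 d, u₁ r ≠ 0) (hz : ∀ r ∈ Ioo 0 d, u₂ r = 0) {δ : ℝ} (hδ : δ ∈ Ioc 0 T)
    {k : ℝ} (hpos : 0 < P {ω | k < pathIntegral u₂ c₂ fun r => B r ω}) (N : ℕ) :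
    ∃ K : ℝ, ∀ ψ : ℝ → ℝ, Continuous ψ → (∀ z, k < z → K ≤ ψ z) →
      ∀ M : AdaptiveMethod δ T, ∫⁻ ω, M.numEval (fun r => B r ω) ∂P ≤ N → ∀ C : ℝ,
      ENNReal.ofReal (1 / 128) * P {ω | k < pathIntegral u₂ c₂ fun r => B r ω} ≤
      ∫⁻ ω, ‖Real.cos ((pathIntegral u₁ c₁ fun r => B r ω) *
        ψ (pathIntegral u₂ c₂ fun r => B r ω)) - M.result (fun r => B r ω) 3 / C‖ₑ ∂P := by
  obtain ⟨n, hn⟩ := ENNReal.exists_nat_mul_gt (ENNReal.div_pos hpos.ne' (by norm_num)).ne'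
    (ENNReal.natCast_ne_top N) (a := P {ω | k < pathIntegral u₂ c₂ fun r => B r ω} / 2)
  have hn0 : 0 < n := by
    rcases Nat.eq_zero_or_pos n with h | h
    · simp [h] at hn
    · exact h
  have hnR : (0 : ℝ) < n := by exact_mod_cast hn0
  have hd' : 0 < min δ d := lt_min hδ.1 hd
  -- The 2n intervals of length η tile (0, min δ d), where evaluations are restricted, u₁ has no
  -- zeros and u₂ vanishes.
  set η : ℝ := min δ d / (2 * n) with hη
  have hη0 : 0 < η := by positivity
  let s : Fin (2 * n) → ℝ := fun j => (j : ℕ) * η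
  let t : Fin (2 * n) → ℝ := fun j => ((j : ℕ) + 1) * η
  have hs : ∀ j, 0 ≤ s j := fun j => by positivity
  have hts : ∀ j, t j - s j = η := fun j => by simp only [s, t]; ring
  have hst : ∀ j, s j < t j := fun j => by linarith [hts j]
  have ht : ∀ j, t j ≤ min δ d := fun j => by
    have h1 : ((j : ℕ) : ℝ) + 1 ≤ 2 * n := by exact_mod_cast j.2
    have h2 : (2 * n : ℝ) * η = min δ d := by rw [hη]; field_simp
    rw [← h2]
    exact mul_le_mul_of_nonneg_right h1 hη0.le
  have hin : ∀ j, ∀ r ∈ Ioo (s j) (t j), r ∈ Ioo 0 d := fun j r hr =>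
    ⟨(hs j).trans_lt hr.1, hr.2.trans_le ((ht j).trans (min_le_right _ _))⟩
  have hdisj : ∀ i j, i ≠ j → Disjoint (Ioo (s i) (t i)) (Ioo (s j) (t j)) := by
    have hlt : ∀ i j : Fin (2 * n), i < j → t i ≤ s j := fun i j hij => by
      have h1 : ((i : ℕ) : ℝ) + 1 ≤ (j : ℕ) := by exact_mod_cast hij
      exact mul_le_mul_of_nonneg_right h1 hη0.le
    intro i j hij
    rw [Set.disjoint_left]
    intro r hi hj
    rcases lt_or_gt_of_ne hij with h | h
    · linarith [hlt i j h, hi.2, hj.1]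
    · linarith [hlt j i h, hj.2, hi.1]
  have hq : ∀ j, pathIntegral u₁ c₁ (tent (s j) (t j)) ≠ 0 := fun j =>
    pathIntegral_tent_ne_zero hu₁ (hs j) (hst j)
      ((ht j).trans ((min_le_right _ _).trans hdc)) fun r hr => hne r (hin j r hr)
  -- The fraction yields η/4 · (qψ)² ≥ 4 once ψ² exceeds it; the summand 1 ensures ψ ≥ 1, hence ψ ≤
  -- ψ². The sum of all L j then bounds every one of them.
  let L : Fin (2 * n) → ℝ := fun j =>
    1 + 16 / (η * pathIntegral u₁ c₁ (tent (s j) (t j)) ^ 2)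
  have hL : ∀ j, 1 ≤ L j := fun j => by
    have : 0 ≤ 16 / (η * pathIntegral u₁ c₁ (tent (s j) (t j)) ^ 2) := by positivity
    simp only [L]; linarith
  refine ⟨∑ j, L j, fun ψ hψ hψK M hM C => ?_⟩
  refine le_lintegral_of_lintegral_numEval_le hB (hδ.1.le.trans hδ.2) hδ.1.le hδ.2 hu₁ hu₂ hψ
    hc₁ hc₂ hn0 hs hst (fun j => (ht j).trans (min_le_left _ _)) hdisj
    (fun j => pathIntegral_tent_eq_zero (hst j) fun r hr => hz r (hin j r hr))
    (fun j z hkz => ?_) C hM hn.le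
  have h1 : L j ≤ ψ z := (Finset.single_le_sum (f := L)
    (fun i _ => zero_le_one.trans (hL i)) (Finset.mem_univ j)).trans (hψK z hkz)
  have hq2 : 0 < pathIntegral u₁ c₁ (tent (s j) (t j)) ^ 2 := by
    have := hq j; positivity
  have h2 : 16 / (η * pathIntegral u₁ c₁ (tent (s j) (t j)) ^ 2) ≤ ψ z ^ 2 := by
    have h3 : 16 / (η * pathIntegral u₁ c₁ (tent (s j) (t j)) ^ 2) ≤ ψ z := by
      simp only [L] at h1; linarith
    have h4 : 1 ≤ ψ z := (hL j).trans h1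
    nlinarith
  rw [div_le_iff₀ (mul_pos hη0 hq2)] at h2
  rw [hts]
  nlinarith

end MainTheorem

theorem corollary2 {Ω : Type*} {mΩ : MeasurableSpace Ω} (P : Measure Ω) [IsProbabilityMeasure P]
    (T : ℝ) (hT : 0 < T)
    (𝓕 : Filtration ℝ mΩ) (h𝓕 : IsNormalFiltration P T 𝓕)
    (W : ℝ → Ω → ℝ) (hW : IsStandardBrownianMotion P T 𝓕 W)
    (τ₁ τ₂ : ℝ) (hτ₁ : 0 < τ₁) (hτ₁₂ : τ₁ < τ₂) (hτ₂ : τ₂ < T)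
    (f g h : ℝ → ℝ)
    (hf : ContDiff ℝ (⊤ : ℕ∞) f) (hg : ContDiff ℝ (⊤ : ℕ∞) g) (hh : ContDiff ℝ (⊤ : ℕ∞) h)
    (hf_bdd : ∃ C : ℝ, ∀ x, |f x| ≤ C) (hg_bdd : ∃ C : ℝ, ∀ x, |g x| ≤ C)
    (hh_bdd : ∃ C : ℝ, ∀ x, |h x| ≤ C)
    (hf_supp : Function.support f ⊆ Iic τ₁)
    (hf_deriv : 0 < sInf ((fun t => |deriv f t|) '' Icc 0 (τ₁ / 2)))
    (hg_supp : Function.support g ⊆ Icc τ₁ τ₂) (hg_ne : g ≠ 0)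
    (hh_supp : Function.support h ⊆ Ici τ₂) (hh_int : (∫ t in τ₂..T, h t) ≠ 0)
    (a δ : ℕ → ℝ) (ha_pos : ∀ N, 1 ≤ N → 0 < a N) (hδ_mem : ∀ N, 1 ≤ N → δ N ∈ Ioc 0 T)
    (ha : Tendsto a atTop (𝓝 0)) (hδ : Tendsto δ atTop (𝓝 0)) :
    ∃ κ : ℝ, 0 < κ ∧ ∃ ψ : ℝ → ℝ, ContDiff ℝ (⊤ : ℕ∞) ψ ∧
      (∃ X : ℝ → Ω → EuclideanSpace ℝ (Fin 4),
        IsStrongSolution P T 𝓕 W (driftCoeff h ψ) (diffusionCoeff f g) 0 X) ∧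
      ∀ X : ℝ → Ω → EuclideanSpace ℝ (Fin 4),
        IsStrongSolution P T 𝓕 W (driftCoeff h ψ) (diffusionCoeff f g) 0 X →
        ∀ N : ℕ, 1 ≤ N →
          ENNReal.ofReal (κ * a N) ≤
            ⨅ M ∈ adaptiveMethods P W (δ N) T N,
              ∫⁻ ω, ‖X T ω - M.result (fun t => W t ω)‖ₑ ∂P := by
  obtain ⟨B, hB, hBW⟩ := hW.exists_continuous_version h𝓕 hT.le
  have hf1 : ContDiff ℝ 1 f := hf.of_le (by exact_mod_cast le_top)
  have hg1 : ContDiff ℝ 1 g := hg.of_le (by exact_mod_cast le_top)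
  have hf0 : ∀ x, τ₁ < x → f x = 0 := fun x hx => by
    by_contra hc; exact absurd (hf_supp hc) (not_le.2 hx)
  have hg0 : ∀ x, τ₂ < x → g x = 0 := fun x hx => by
    by_contra hc; exact absurd (hg_supp hc).2 (not_le.2 hx)
  have hg0' : ∀ x, x < τ₁ → g x = 0 := fun x hx => by
    by_contra hc; exact absurd (hg_supp hc).1 (not_le.2 hx)
  have hh0 : ∀ x, x < τ₂ → h x = 0 := fun x hx => by
    by_contra hc; exact absurd (hh_supp hc) (not_le.2 hx)
  have hfd : ∀ r ∈ Ioo 0 (τ₁ / 2), deriv f r ≠ 0 := fun r hr hc => by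
    have h1 : sInf ((fun t => |deriv f t|) '' Icc 0 (τ₁ / 2)) ≤ |deriv f r| :=
      csInf_le ⟨0, by rintro _ ⟨x, -, rfl⟩; exact abs_nonneg _⟩ ⟨r, Ioo_subset_Icc_self hr, rfl⟩
    rw [hc, abs_zero] at h1
    linarith
  have hu₁ : Continuous (deriv f) := hf1.continuous_deriv le_rfl
  have hu₂ : Continuous (deriv g) := hg1.continuous_deriv le_rfl
  have hc₁ : τ₁ ∈ Icc 0 T := ⟨hτ₁.le, by linarith⟩
  have hc₂ : τ₂ ∈ Icc 0 T := ⟨by linarith, hτ₂.le⟩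
  obtain ⟨s, t, hs, hst, ht, hgd⟩ := exists_Ioo_deriv_ne_zero hg1 hg_supp hg_ne
  have hpos : ∀ k : ℝ, 0 < P {ω | k < pathIntegral (deriv g) τ₂ fun r => B r ω} :=
    measure_pathIntegral_gt_pos hB hu₂ hc₂ (by linarith) hst (by linarith)
      (pathIntegral_tent_ne_zero hu₂ (by linarith) hst ht hgd)
  obtain ⟨κ, hκ, k, hk, hkp⟩ := exists_tendsto_atTop_forall_le
    (fun j => P.real {ω | (j : ℝ) < pathIntegral (deriv g) τ₂ fun r => B r ω}) a
    (fun j => ENNReal.toReal_pos (hpos j).ne' (measure_ne_top _ _)) ha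
  -- The thresholds are fixed before ψ and are uniform over methods; the index N = 0 receives a
  -- dummy value.
  have hK : ∀ N, ∃ K : ℝ, 1 ≤ N → ∀ ψ : ℝ → ℝ, Continuous ψ → (∀ z, (k N : ℝ) < z → K ≤ ψ z) →
      ∀ M : AdaptiveMethod (δ N) T, ∫⁻ ω, M.numEval (fun r => B r ω) ∂P ≤ N → ∀ C : ℝ,
      ENNReal.ofReal (1 / 128) * P {ω | (k N : ℝ) < pathIntegral (deriv g) τ₂ fun r => B r ω} ≤
      ∫⁻ ω, ‖Real.cos ((pathIntegral (deriv f) τ₁ fun r => B r ω) *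
        ψ (pathIntegral (deriv g) τ₂ fun r => B r ω)) - M.result (fun r => B r ω) 3 / C‖ₑ ∂P := by
    intro N
    by_cases hN : 1 ≤ N
    · obtain ⟨K, hK⟩ := exists_frequency_bound hB hu₁ hu₂ hc₁ hc₂ (half_pos hτ₁)
        (half_le_self hτ₁.le) hfd
        (fun r hr => deriv_eq_zero_of_eqOn_Iio hg0' (by linarith [hr.2])) (hδ_mem N hN)
        (hpos (k N)) N
      exact ⟨K, fun _ => hK⟩
    · exact ⟨0, fun h => absurd h hN⟩
  choose K hK using hK
  obtain ⟨ψ, hψ, hψK⟩ := exists_contDiff_forall_le (fun N => (k N : ℝ)) K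
    (tendsto_natCast_atTop_atTop.comp hk)
  set C : ℝ := ∫ r in τ₂..T, h r with hC
  have hC0 : 0 < |C| := abs_pos.2 hh_int
  refine ⟨|C| * (1 / 128 * κ), by positivity, ψ, hψ, ⟨_, isStrongSolution_pathwiseSolution hB hT hBW
    hf1 hg1 hh.continuous hψ.continuous⟩, fun X hX N hN => le_iInf₂ fun M hM => ?_⟩
  have hterm := hX.ae_eq_terminal hB hT hBW hf1 hg1 hh.continuous hψ.continuous hτ₁₂.le hc₂.1 hτ₂.le
    hf0 hg0 hh0
  have hδN := hδ_mem N hN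
  have hnum : ∫⁻ ω, M.numEval (fun r => B r ω) ∂P ≤ N := by
    refine le_of_eq_of_le (lintegral_congr_ae ?_) hM.2
    filter_upwards [hBW] with ω hω
    exact AdaptiveMethod.numEval_congr hδN.1.le hδN.2 hω
  have key := hK N hN ψ hψ.continuous (hψK N) M hnum C
  calc ENNReal.ofReal (|C| * (1 / 128 * κ) * a N)
      ≤ ENNReal.ofReal |C| * (ENNReal.ofReal (1 / 128) *
          P {ω | (k N : ℝ) < pathIntegral (deriv g) τ₂ fun r => B r ω}) := by
        rw [← ofReal_measureReal, ← ENNReal.ofReal_mul (by norm_num),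
          ← ENNReal.ofReal_mul hC0.le, mul_assoc, mul_assoc]
        gcongr
        exact hkp N
    _ ≤ ENNReal.ofReal |C| * ∫⁻ ω, ‖Real.cos ((pathIntegral (deriv f) τ₁ fun r => B r ω) *
        ψ (pathIntegral (deriv g) τ₂ fun r => B r ω)) - M.result (fun r => B r ω) 3 / C‖ₑ ∂P := by
        gcongr
    _ ≤ ∫⁻ ω, ‖X T ω - M.result (fun t => W t ω)‖ₑ ∂P := by
        rw [← lintegral_const_mul' _ _ ENNReal.ofReal_ne_top]
        refine lintegral_mono_ae ?_
        filter_upwards [hterm, hBW] with ω h1 h2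
        rw [← AdaptiveMethod.result_congr hδN.1.le hδN.2 h2, ← Real.enorm_eq_ofReal_abs,
          ← enorm_mul]
        -- Only the last coordinate of the error is used; dividing the output by C turns it into an
        -- approximation of the cosine itself.
        have h3 : C * (Real.cos ((pathIntegral (deriv f) τ₁ fun r => B r ω) *
            ψ (pathIntegral (deriv g) τ₂ fun r => B r ω)) - M.result (fun r => B r ω) 3 / C) =
            (X T ω - M.result (fun r => B r ω)) 3 := by
          rw [mul_sub, mul_div_cancel₀ _ hh_int, PiLp.sub_apply, h1]
          rfl
        rw [h3]
        exact enorm_le_iff_norm_le.2 (PiLp.norm_apply_le _ 3)
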